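/- For finite graphs $G$ on $n$ vertices and $H$ on $h$ vertices, let $p_H(G)=\binom{n}{h}^{-1}D_H(G)$, where $D_H(G)$ is the number of vertex sets $S\subseteq V(G)$ such that the induced subgraph $G[S]$ is isomorphic to $H$. Write $p_3(G)=p_{K_3}(G)$ and $p_0(G)=p_{\overline{K_3}}(G)$ for the densities of triangles and anti-triangles. All sequences $\mathcal G=(G_k)_{k\ge 1}$ below are sequences of finite graphs with $|V(G_k)|\to\infty$. Such a sequence is called $3$-random-like if $\lim_{k\to\infty}p_0(G_k)=\lim_{k\to\infty}p_3(G_k)=1/8$, and it is called $4$-universal if, for all sufficiently large $k$, $G_k$ contains every graph on $4$ vertices as an induced subgraph. Theorem. Every $3$-random-like sequence is $4$-universal. This gives an affirmative answer to a question of Linial and Morgenstern for $4$-vertex graphs: there is an $\varepsilon>0$ such that every sequence $\mathcal G$ for which the limits $p_0(\mathcal G)=\lim_{k\to\infty} p_0(G_k)$ and $p_3(\mathcal G)=\lim_{k\to\infty} p_3(G_k)$ exist and satisfy $p_0(\mathcal G),p_3(\mathcal G)<\frac18+\varepsilon$ is $4$-universal. -/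

import Mathlib

open Filter Topology

universe u v

namespace RandomLike

/-- The number `D_H(G)` of induced copies of `H` in `G`: the number of vertex sets `S`
of `G` such that `G[S]` is isomorphic to `H`. -/
noncomputable def inducedCount {V : Type u} {W : Type v} [Fintype V]
    (H : SimpleGraph W) (G : SimpleGraph V) : ℕ :=
  Nat.card {S : Finset V // Nonempty (G.induce (S : Set V) ≃g H)}

/-- The density `p_H(G) = D_H(G) / (|G| choose |H|)` of induced copies of `H` in `G`. -/
noncomputable def density {V : Type u} {W : Type v} [Fintype V] [Fintype W]
    (H : SimpleGraph W) (G : SimpleGraph V) : ℝ :=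
  (inducedCount H G : ℝ) / ((Fintype.card V).choose (Fintype.card W) : ℝ)

/-- A graph is `l`-universal if it contains every `l`-vertex graph as an induced subgraph. -/
def IsUniversalGraph {V : Type u} (l : ℕ) (G : SimpleGraph V) : Prop :=
  ∀ H : SimpleGraph (Fin l), H.IsIndContained G

/-- A sequence of finite graphs whose orders tend to infinity. -/
structure GraphSeq where
  /-- the vertex set of the `k`-th graph -/
  V : ℕ → Type u
  /-- every graph of the sequence is finite -/
  fintypeV : ∀ k, Fintype (V k)
  /-- the `k`-th graph -/
  graph : ∀ k, SimpleGraph (V k)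
  /-- the orders of the graphs tend to infinity -/
  tendsto_order : Tendsto (fun k => @Fintype.card (V k) (fintypeV k)) atTop atTop

attribute [instance] GraphSeq.fintypeV

/-- `p_H` of a sequence exists and equals `x`: the densities `p_H(G_k)` converge to `x`. -/
def GraphSeq.HasDensity (𝒢 : GraphSeq.{u}) {W : Type v} [Fintype W] (H : SimpleGraph W)
    (x : ℝ) : Prop :=
  Tendsto (fun k => density H (𝒢.graph k)) atTop (𝓝 x)

/-- A sequence is `t`-random-like if the densities of `t`-cliques and of independent
`t`-sets both converge to `2 ^ (-(t choose 2))`. -/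
def GraphSeq.IsRandomLike (𝒢 : GraphSeq.{u}) (t : ℕ) : Prop :=
  𝒢.HasDensity (⊤ : SimpleGraph (Fin t)) ((1 / 2 : ℝ) ^ t.choose 2) ∧
    𝒢.HasDensity (⊥ : SimpleGraph (Fin t)) ((1 / 2 : ℝ) ^ t.choose 2)

/-- A sequence is `l`-universal if all but finitely many of its graphs are. -/
def GraphSeq.IsUniversal (𝒢 : GraphSeq.{u}) (l : ℕ) : Prop :=
  ∀ᶠ k in atTop, IsUniversalGraph l (𝒢.graph k)

end RandomLike

open scoped BigOperators

/-! Let W be the `±1` adjacency kernel. Goodman's identity (`goodman`) writes the sum of the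
triangle and anti-triangle densities as 1/4 plus 3/4 of the mean squared signed degree, and their
difference through the mean signed degree and the signed triangle density. If both densities are at
most about 1/8, then almost all degrees are near n/2 and the signed triangle density is near 0. A
limit of random six-vertex samples along an ultrafilter then satisfies `IsQuasiRegular`. A graph H
missing from infinitely many such graphs would have pattern probability 0 in a limit, so it is
enough to prove `pattern_pos`.

Expand the indicator of a four-vertex pattern into products of signs. Terms with a vertex of degree
one vanish by regularity, and the triangles vanish too. What remains is a linear form in the signed
densities C, D, K of the 4-cycle, the diamond and the 4-clique (`ev_pattern`). Positive
semidefiniteness gives C ± D ≥ 0, and all patterns follow linearly from this once the paw, the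
diamond and their complements are known to have positive density. Complements come for free by
symmetry (`IsQuasiRegular.compl`).

If the paw or the diamond had density 0, then adjacent vertices of a triangle would almost surely be
twins (`split_of_paw_free`, `split_of_diamond_free`). The graph would then be a union of two cliques
of half the size, whose signed triangle density is 1 instead of 0 (`split_pos`). -/

namespace RandomLike

/-! ### Signed kernels and the axioms of the limiting six-vertex sample -/

section Core

open Classical in
/-- The `0/1`-valued adjacency kernel of a graph. -/
noncomputable def adjInd {V : Type*} (G : SimpleGraph V) (a b : V) : ℝ :=
  if G.Adj a b then 1 else 0

/-- The `±1`-valued adjacency kernel of a graph. -/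
noncomputable def adjSign {V : Type*} (G : SimpleGraph V) (a b : V) : ℝ :=
  2 * adjInd G a b - 1

lemma adjInd_comm {V : Type*} (G : SimpleGraph V) (a b : V) : adjInd G a b = adjInd G b a := by
  by_cases h : G.Adj a b
  · simp [adjInd, h, h.symm]
  · have h' : ¬ G.Adj b a := fun h' => h h'.symm
    simp [adjInd, h, h']

lemma adjSign_comm {V : Type*} (G : SimpleGraph V) (a b : V) : adjSign G a b = adjSign G b a := by
  simp [adjSign, adjInd_comm]

lemma adjInd_nonneg {V : Type*} (G : SimpleGraph V) (a b : V) : 0 ≤ adjInd G a b := by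
  unfold adjInd; split_ifs <;> norm_num

lemma adjInd_le_one {V : Type*} (G : SimpleGraph V) (a b : V) : adjInd G a b ≤ 1 := by
  unfold adjInd; split_ifs <;> norm_num

lemma adjInd_eq_zero_or_one {V : Type*} (G : SimpleGraph V) (a b : V) :
    adjInd G a b = 0 ∨ adjInd G a b = 1 := by
  unfold adjInd; split_ifs <;> simp

lemma adjSign_mul_self {V : Type*} (G : SimpleGraph V) (a b : V) :
    adjSign G a b * adjSign G a b = 1 := by
  unfold adjSign
  rcases adjInd_eq_zero_or_one G a b with h | h <;> rw [h] <;> norm_num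

lemma abs_adjSign {V : Type*} (G : SimpleGraph V) (a b : V) : |adjSign G a b| = 1 := by
  unfold adjSign
  rcases adjInd_eq_zero_or_one G a b with h | h <;> rw [h] <;> norm_num

lemma adjInd_comap {V W : Type*} (G : SimpleGraph V) (x : W → V) (i j : W) :
    adjInd (G.comap x) i j = adjInd G (x i) (x j) := by
  by_cases h : G.Adj (x i) (x j) <;> simp [adjInd, h]

lemma adjSign_comap {V W : Type*} (G : SimpleGraph V) (x : W → V) (i j : W) :
    adjSign (G.comap x) i j = adjSign G (x i) (x j) := by
  simp [adjSign, adjInd_comap]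

lemma adjInd_compl {V : Type*} (G : SimpleGraph V) {a b : V} (h : a ≠ b) :
    adjInd Gᶜ a b = 1 - adjInd G a b := by
  by_cases hG : G.Adj a b <;> simp [adjInd, hG, h]

lemma adjSign_compl {V : Type*} (G : SimpleGraph V) {a b : V} (h : a ≠ b) :
    adjSign Gᶜ a b = - adjSign G a b := by
  simp only [adjSign, adjInd_compl G h]; ring

/-- A graph parameter that does not depend on the edges at the vertex `j`. -/
def Avoids {W : Type*} (j : W) (f : SimpleGraph W → ℝ) : Prop :=
  ∀ ω ω' : SimpleGraph W,
    (∀ a b, a ≠ j → b ≠ j → adjInd ω a b = adjInd ω' a b) → f ω = f ω'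

/-- Expectation with respect to a weight function on a finite type. -/
noncomputable def ev {α : Type*} [Finite α] (p : α → ℝ) : (α → ℝ) →ₗ[ℝ] ℝ :=
  letI := Fintype.ofFinite α
  ∑ a, p a • LinearMap.proj a

lemma ev_apply {α : Type*} [Fintype α] (p f : α → ℝ) : ev p f = ∑ a, p a * f a := by
  simp only [ev, LinearMap.coe_sum, Finset.sum_apply, LinearMap.smul_apply, LinearMap.proj_apply,
    smul_eq_mul]
  congr!

lemma ev_mono_of_support {α : Type*} [Finite α] {p f g : α → ℝ} (hp : ∀ a, 0 ≤ p a)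
    (h : ∀ a, 0 < p a → f a ≤ g a) : ev p f ≤ ev p g := by
  have := Fintype.ofFinite α
  rw [ev_apply, ev_apply]
  refine Finset.sum_le_sum fun a _ => ?_
  rcases (hp a).eq_or_lt with h0 | h0
  · simp [← h0]
  · exact mul_le_mul_of_nonneg_left (h a h0) h0.le

lemma ev_const_of_one {α : Type*} [Finite α] {p : α → ℝ} (hp : ev p (fun _ => 1) = 1) (c : ℝ) :
    ev p (fun _ => c) = c := by
  have e : (fun _ : α => c) = c • (fun _ => (1 : ℝ)) := by funext; simp
  rw [e, map_smul, hp]; simp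

lemma eq_zero_of_ev_nonpos {α : Type*} [Finite α] {p f : α → ℝ} (hp : ∀ a, 0 ≤ p a)
    (h : ∀ a, 0 ≤ f a) (h0 : ev p f ≤ 0) (a : α) (ha : 0 < p a) : f a = 0 := by
  have := Fintype.ofFinite α
  rw [ev_apply] at h0
  have h1 := (Finset.sum_eq_zero_iff_of_nonneg fun a _ => mul_nonneg (hp a) (h a)).1
    (le_antisymm h0 (Finset.sum_nonneg fun a _ => mul_nonneg (hp a) (h a))) a
    (Finset.mem_univ _)
  exact (mul_eq_zero.1 h1).resolve_left ha.ne'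

/-- The distributions of random six-vertex samples arising in the limit from graphs that are
asymptotically `1/2`-regular and have triangle and anti-triangle densities tending to `1/8`. -/
structure IsQuasiRegular (p : SimpleGraph (Fin 6) → ℝ) : Prop where
  nonneg : ∀ ω, 0 ≤ p ω
  ev_one : ev p (fun _ => 1) = 1
  comap : ∀ (σ : Equiv.Perm (Fin 6)) (f : SimpleGraph (Fin 6) → ℝ),
    ev p (fun ω => f (ω.comap σ)) = ev p f
  regular : ∀ (f : SimpleGraph (Fin 6) → ℝ) (i j : Fin 6), i ≠ j → Avoids j f →
    ev p (fun ω => f ω * adjSign ω i j) = 0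
  triangle : ∀ (f : SimpleGraph (Fin 6) → ℝ) (i j k : Fin 6), i ≠ j → j ≠ k → i ≠ k →
    Avoids i f → Avoids j f → Avoids k f →
    ev p (fun ω => f ω * (adjSign ω i j * adjSign ω j k * adjSign ω i k)) = 0
  gram : ∀ (h f : SimpleGraph (Fin 6) → ℝ) (i j : Fin 6), i ≠ j → (∀ ω, 0 ≤ h ω) →
    Avoids i h → Avoids j h → Avoids j f →
    0 ≤ ev p (fun ω => h ω * (f ω * f (ω.comap (Equiv.swap i j))))

namespace IsQuasiRegular

variable {p : SimpleGraph (Fin 6) → ℝ}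

lemma ev_mono (hp : IsQuasiRegular p) {f g : SimpleGraph (Fin 6) → ℝ}
    (h : ∀ ω, 0 < p ω → f ω ≤ g ω) : ev p f ≤ ev p g :=
  ev_mono_of_support hp.nonneg h

lemma ev_congr (hp : IsQuasiRegular p) {f g : SimpleGraph (Fin 6) → ℝ}
    (h : ∀ ω, 0 < p ω → f ω = g ω) : ev p f = ev p g :=
  le_antisymm (hp.ev_mono fun ω hω => (h ω hω).le) (hp.ev_mono fun ω hω => (h ω hω).ge)

lemma ev_const (hp : IsQuasiRegular p) (c : ℝ) : ev p (fun _ => c) = c :=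
  ev_const_of_one hp.ev_one c

lemma ev_nonneg (hp : IsQuasiRegular p) {f : SimpleGraph (Fin 6) → ℝ}
    (h : ∀ ω, 0 ≤ f ω) : 0 ≤ ev p f :=
  (hp.ev_const 0).symm.trans_le (hp.ev_mono fun ω _ => h ω)

lemma eq_zero_of_ev_le_zero (hp : IsQuasiRegular p) {f : SimpleGraph (Fin 6) → ℝ}
    (h : ∀ ω, 0 ≤ f ω) (h0 : ev p f ≤ 0) (ω : SimpleGraph (Fin 6)) (hω : 0 < p ω) : f ω = 0 :=
  eq_zero_of_ev_nonpos hp.nonneg h h0 ω hω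

/-- A null event on some vertices is null on all equally many vertices. -/
lemma eq_zero_of_injective (hp : IsQuasiRegular p) {n : ℕ} (ι : Fin n → Fin 6)
    (hι : Function.Injective ι) (f : SimpleGraph (Fin n) → ℝ) (h : ∀ ω, 0 ≤ f ω)
    (h0 : ev p (fun ω => f (ω.comap ι)) ≤ 0) (κ : Fin n → Fin 6) (hκ : Function.Injective κ)
    (ω : SimpleGraph (Fin 6)) (hω : 0 < p ω) : f (ω.comap κ) = 0 := by
  obtain ⟨σ, hσ⟩ := Equiv.Perm.exists_extending_pair ι κ hι hκ
  have h1 := hp.comap σ (fun ω => f (ω.comap ι))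
  have h2 : (fun ω : SimpleGraph (Fin 6) => f ((ω.comap σ).comap ι)) =
      fun ω => f (ω.comap κ) := by
    funext ω
    rw [SimpleGraph.comap_comap]
    congr 2
    funext i; exact hσ i
  simp only [h2] at h1
  exact hp.eq_zero_of_ev_le_zero (fun ω => h _) (h1.trans_le h0) ω hω

/-- Cauchy-Schwarz for two conditionally independent copies. -/
lemma sq_ev_le (hp : IsQuasiRegular p) (f : SimpleGraph (Fin 6) → ℝ) {i j : Fin 6} (hij : i ≠ j)
    (hf : Avoids j f) : ev p f ^ 2 ≤ ev p (fun ω => f ω * f (ω.comap (Equiv.swap i j))) := by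
  set m := ev p f with hm
  -- Centring `f` at its mean turns the nonnegative Gram expression into the second moment of two
  -- copies minus `m ^ 2`.
  have h1 := hp.gram (fun _ => 1) (fun ω => f ω - m) i j hij (fun _ => zero_le_one)
    (fun _ _ _ => rfl) (fun _ _ _ => rfl) (fun ω ω' h => by simp only [hf ω ω' h])
  have h2 := hp.comap (Equiv.swap i j) f
  have e : (fun ω => (1 : ℝ) * ((f ω - m) * (f (ω.comap (Equiv.swap i j)) - m))) =
      (fun ω => f ω * f (ω.comap (Equiv.swap i j))) - m • f
        - m • (fun ω => f (ω.comap (Equiv.swap i j))) + (fun _ => m ^ 2) := by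
    funext ω; simp; ring
  rw [e, map_add, map_sub, map_sub, map_smul, map_smul, h2, ← hm, hp.ev_const] at h1
  simp only [smul_eq_mul] at h1
  nlinarith

/-- Regularity in probabilistic form: conditionally on everything away from `j`, each other vertex
is adjacent to `j` with probability 1/2. All measures of neighbourhoods below come from here. -/
lemma ev_mul_adjInd (hp : IsQuasiRegular p) (f : SimpleGraph (Fin 6) → ℝ) {i j : Fin 6}
    (hij : i ≠ j) (hf : Avoids j f) :
    ev p (fun ω => f ω * adjInd ω i j) = ev p f / 2 := by
  have h := hp.regular f i j hij hf
  have e : (fun ω => f ω * adjSign ω i j) = (2 : ℝ) • (fun ω => f ω * adjInd ω i j) - f := by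
    funext ω; simp [adjSign]; ring
  rw [e, map_sub, map_smul, smul_eq_mul] at h
  linarith

end IsQuasiRegular

end Core

/-! ### Positive density of paws and diamonds -/

lemma adjInd_eq_zero {V : Type*} {G : SimpleGraph V} {a b : V} :
    adjInd G a b = 0 ↔ ¬ G.Adj a b := by
  by_cases h : G.Adj a b <;> simp [adjInd, h]

lemma one_sub_adjInd_eq_zero {V : Type*} {G : SimpleGraph V} {a b : V} :
    1 - adjInd G a b = 0 ↔ G.Adj a b := by
  by_cases h : G.Adj a b <;> simp [adjInd, h]

/-- Indicator of a triangle `a b c`. -/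
noncomputable def triInd {V : Type*} (G : SimpleGraph V) (a b c : V) : ℝ :=
  adjInd G a b * adjInd G a c * adjInd G b c

/-- Indicator of a triangle `a b c` with a vertex `d` adjacent to `a` only. -/
noncomputable def pawInd {V : Type*} (G : SimpleGraph V) (a b c d : V) : ℝ :=
  triInd G a b c * (adjInd G a d * (1 - adjInd G b d) * (1 - adjInd G c d))

/-- Indicator of a triangle `a b c` with a vertex `d` adjacent to `a` and `b` only. -/
noncomputable def diamondInd {V : Type*} (G : SimpleGraph V) (a b c d : V) : ℝ :=
  triInd G a b c * (adjInd G a d * adjInd G b d * (1 - adjInd G c d))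

/-- Indicator of `d` being adjacent to exactly one of `a` and `b`. -/
noncomputable def splitInd {V : Type*} (G : SimpleGraph V) (a b d : V) : ℝ :=
  adjInd G a d + adjInd G b d - 2 * (adjInd G a d * adjInd G b d)

lemma triInd_nonneg {V : Type*} (G : SimpleGraph V) (a b c : V) : 0 ≤ triInd G a b c :=
  mul_nonneg (mul_nonneg (adjInd_nonneg ..) (adjInd_nonneg ..)) (adjInd_nonneg ..)

lemma one_sub_adjInd_nonneg {V : Type*} (G : SimpleGraph V) (a b : V) : 0 ≤ 1 - adjInd G a b :=
  sub_nonneg.2 (adjInd_le_one ..)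

lemma pawInd_nonneg {V : Type*} (G : SimpleGraph V) (a b c d : V) : 0 ≤ pawInd G a b c d :=
  mul_nonneg (triInd_nonneg ..) (mul_nonneg (mul_nonneg (adjInd_nonneg ..)
    (one_sub_adjInd_nonneg ..)) (one_sub_adjInd_nonneg ..))

lemma diamondInd_nonneg {V : Type*} (G : SimpleGraph V) (a b c d : V) :
    0 ≤ diamondInd G a b c d :=
  mul_nonneg (triInd_nonneg ..) (mul_nonneg (mul_nonneg (adjInd_nonneg ..)
    (adjInd_nonneg ..)) (one_sub_adjInd_nonneg ..))

lemma splitInd_nonneg {V : Type*} (G : SimpleGraph V) (a b d : V) : 0 ≤ splitInd G a b d := by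
  unfold splitInd
  rcases adjInd_eq_zero_or_one G a d with h | h <;>
  rcases adjInd_eq_zero_or_one G b d with h' | h' <;> rw [h, h'] <;> norm_num

namespace IsQuasiRegular

variable {p : SimpleGraph (Fin 6) → ℝ}

lemma paw_free (hp : IsQuasiRegular p) (h : ev p (fun ω => pawInd ω 0 1 2 3) ≤ 0)
    {ω : SimpleGraph (Fin 6)} (hω : 0 < p ω) (a b c d : Fin 6)
    (hi : Function.Injective ![a, b, c, d]) :
    ¬ (ω.Adj a b ∧ ω.Adj a c ∧ ω.Adj b c ∧ ω.Adj a d ∧ ¬ ω.Adj b d ∧ ¬ ω.Adj c d) := by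
  have h1 := hp.eq_zero_of_injective ![0, 1, 2, 3] (by decide) (fun ω => pawInd ω 0 1 2 3)
    (fun ω => pawInd_nonneg ..)
    (by simpa [pawInd, triInd, adjInd_comap] using h) ![a, b, c, d] hi ω hω
  simp only [pawInd, triInd, adjInd_comap, mul_eq_zero, adjInd_eq_zero, one_sub_adjInd_eq_zero,
    Matrix.cons_val] at h1
  tauto

lemma diamond_free (hp : IsQuasiRegular p) (h : ev p (fun ω => diamondInd ω 0 1 2 3) ≤ 0)
    {ω : SimpleGraph (Fin 6)} (hω : 0 < p ω) (a b c d : Fin 6)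
    (hi : Function.Injective ![a, b, c, d]) :
    ω.Adj a b → ω.Adj a c → ω.Adj b c → ω.Adj a d → ω.Adj b d → ω.Adj c d := by
  have h1 := hp.eq_zero_of_injective ![0, 1, 2, 3] (by decide) (fun ω => diamondInd ω 0 1 2 3)
    (fun ω => diamondInd_nonneg ..)
    (by simpa [diamondInd, triInd, adjInd_comap] using h) ![a, b, c, d] hi ω hω
  simp only [diamondInd, triInd, adjInd_comap, mul_eq_zero, adjInd_eq_zero,
    one_sub_adjInd_eq_zero, Matrix.cons_val] at h1
  tauto

lemma twins (hp : IsQuasiRegular p) (h : ev p (fun ω => triInd ω 0 1 2 * splitInd ω 0 1 3) ≤ 0)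
    {ω : SimpleGraph (Fin 6)} (hω : 0 < p ω) (a b c d : Fin 6)
    (hi : Function.Injective ![a, b, c, d]) :
    ω.Adj a b → ω.Adj a c → ω.Adj b c → (ω.Adj a d ↔ ω.Adj b d) := by
  have h1 := hp.eq_zero_of_injective ![0, 1, 2, 3] (by decide)
    (fun ω => triInd ω 0 1 2 * splitInd ω 0 1 3)
    (fun ω => mul_nonneg (triInd_nonneg ..) (splitInd_nonneg ..))
    (by simpa [splitInd, triInd, adjInd_comap] using h) ![a, b, c, d] hi ω hω
  simp only [splitInd, triInd, adjInd_comap, Matrix.cons_val] at h1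
  intro h2 h3 h4
  by_cases h5 : ω.Adj a d <;> by_cases h6 : ω.Adj b d <;>
    simp [adjInd, h2, h3, h4, h5, h6] at h1 ⊢

/-- In the expansion into signs, every nonconstant term has a vertex of degree one or is the signed
triangle, hence vanishes. -/
lemma ev_triInd (hp : IsQuasiRegular p) : ev p (fun ω => triInd ω 0 1 2) = 1 / 8 := by
  have e : (fun ω : SimpleGraph (Fin 6) => triInd ω 0 1 2) = (1 / 8 : ℝ) •
      ((fun _ => 1) + (fun ω => 1 * adjSign ω 0 1) + (fun ω => (1 + adjSign ω 0 1) * adjSign ω 0 2)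
      + (fun ω => (1 + adjSign ω 0 1) * adjSign ω 1 2)
      + (fun ω => adjSign ω 0 2 * adjSign ω 2 1)
      + (fun ω => 1 * (adjSign ω 0 1 * adjSign ω 1 2 * adjSign ω 0 2))) := by
    funext ω
    simp [triInd, adjSign, adjInd_comm ω 2 1]
    ring
  rw [e, map_smul, map_add, map_add, map_add, map_add, map_add, hp.ev_one,
    hp.regular (fun _ => 1) 0 1 (by decide) (fun _ _ _ => rfl),
    hp.regular (fun ω => 1 + adjSign ω 0 1) 0 2 (by decide) (by
      intro ω ω' h; simp [adjSign, h]),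
    hp.regular (fun ω => 1 + adjSign ω 0 1) 1 2 (by decide) (by
      intro ω ω' h; simp [adjSign, h]),
    hp.regular (fun ω => adjSign ω 0 2) 2 1 (by decide) (by
      intro ω ω' h; simp [adjSign, h]),
    hp.triangle (fun _ => 1) 0 1 2 (by decide) (by decide) (by decide) (fun _ _ _ => rfl)
      (fun _ _ _ => rfl) (fun _ _ _ => rfl)]
  simp

/-- In the absence of induced paws, adjacent vertices of a triangle are twins. -/
lemma split_of_paw_free (hp : IsQuasiRegular p) (h : ev p (fun ω => pawInd ω 0 1 2 3) ≤ 0) :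
    ev p (fun ω => triInd ω 0 1 2 * splitInd ω 0 1 3) ≤ 0 := by
  set X : SimpleGraph (Fin 6) → ℝ := fun ω => triInd ω 0 1 2 *
    ((1 - adjInd ω 0 3) * (1 - adjInd ω 1 3) * (1 - adjInd ω 2 3)) with hX
  have hX0 : ∀ ω, 0 ≤ X ω := fun ω => mul_nonneg (triInd_nonneg ..) (mul_nonneg (mul_nonneg
    (one_sub_adjInd_nonneg ..) (one_sub_adjInd_nonneg ..)) (one_sub_adjInd_nonneg ..))
  have hX4 : Avoids 4 X := by
    intro ω ω' h; simp [hX, triInd, h]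
  -- On `X`, paw-freeness makes N(3) disjoint from N(0) and from N(1). All three have measure 1/2,
  -- so N(0) and N(1) both equal the complement of N(3), and no vertex 4 separates 0 from 1.
  have h1 : ev p (fun ω => X ω * splitInd ω 0 1 4) ≤ 0 := by
    have e : (fun ω => X ω * splitInd ω 0 1 4) =
        (2 : ℝ) • (fun ω => X ω * (adjInd ω 3 4 + adjInd ω 0 4 + adjInd ω 1 4
          - adjInd ω 0 4 * adjInd ω 1 4 - 1))
        - (fun ω => X ω * adjSign ω 3 4) - (1 / 2 : ℝ) • (fun ω => X ω * adjSign ω 0 4)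
        - (1 / 2 : ℝ) • (fun ω => X ω * adjSign ω 1 4) := by
      funext ω; simp [splitInd, adjSign]; ring
    rw [e, map_sub, map_sub, map_sub, map_smul, map_smul, map_smul,
      hp.regular X 3 4 (by decide) hX4, hp.regular X 0 4 (by decide) hX4,
      hp.regular X 1 4 (by decide) hX4]
    have h2 : ev p (fun ω => X ω * (adjInd ω 3 4 + adjInd ω 0 4 + adjInd ω 1 4
          - adjInd ω 0 4 * adjInd ω 1 4 - 1)) ≤ ev p (fun _ => 0) := by
      refine hp.ev_mono fun ω hω => ?_
      have f1 := hp.paw_free h hω 0 1 2 4 (by decide)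
      have f2 := hp.paw_free h hω 4 0 1 3 (by decide)
      have f3 := hp.paw_free h hω 4 0 2 3 (by decide)
      have f4 := hp.paw_free h hω 1 0 2 4 (by decide)
      have f5 := hp.paw_free h hω 4 1 2 3 (by decide)
      have z1 : X ω * adjInd ω 3 4 * adjInd ω 0 4 = 0 := by
        by_contra hz
        simp only [hX, triInd, mul_eq_zero, adjInd_eq_zero, one_sub_adjInd_eq_zero, not_or,
          not_not] at hz
        obtain ⟨⟨⟨⟨⟨h01, h02⟩, h12⟩, ⟨h03, h13⟩, h23⟩, h34⟩, h04⟩ := hz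
        by_cases h14 : ω.Adj 1 4
        · exact f2 ⟨h04.symm, h14.symm, h01, h34.symm, h03, h13⟩
        by_cases h24 : ω.Adj 2 4
        · exact f3 ⟨h04.symm, h24.symm, h02, h34.symm, h03, h23⟩
        · exact f1 ⟨h01, h02, h12, h04, h14, h24⟩
      have z2 : X ω * adjInd ω 3 4 * adjInd ω 1 4 = 0 := by
        by_contra hz
        simp only [hX, triInd, mul_eq_zero, adjInd_eq_zero, one_sub_adjInd_eq_zero, not_or,
          not_not] at hz
        obtain ⟨⟨⟨⟨⟨h01, h02⟩, h12⟩, ⟨h03, h13⟩, h23⟩, h34⟩, h14⟩ := hz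
        by_cases h04 : ω.Adj 0 4
        · exact f2 ⟨h04.symm, h14.symm, h01, h34.symm, h03, h13⟩
        by_cases h24 : ω.Adj 2 4
        · exact f5 ⟨h14.symm, h24.symm, h12, h34.symm, h13, h23⟩
        · exact f4 ⟨h01.symm, h12, h02, h14, h04, h24⟩
      have z3 := mul_nonneg (hX0 ω) (mul_nonneg (mul_nonneg (one_sub_adjInd_nonneg ω 3 4)
        (one_sub_adjInd_nonneg ω 0 4)) (one_sub_adjInd_nonneg ω 1 4))
      have : X ω * (adjInd ω 3 4 + adjInd ω 0 4 + adjInd ω 1 4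
          - adjInd ω 0 4 * adjInd ω 1 4 - 1) = - (X ω * ((1 - adjInd ω 3 4) * (1 - adjInd ω 0 4) *
          (1 - adjInd ω 1 4))) + X ω * adjInd ω 3 4 * adjInd ω 0 4 * (1 - adjInd ω 1 4)
          + X ω * adjInd ω 3 4 * adjInd ω 1 4 := by ring
      rw [this, z1, z2]
      linarith
    rw [hp.ev_const] at h2
    simp only [smul_eq_mul]
    linarith
  set Y : SimpleGraph (Fin 6) → ℝ := fun ω => triInd ω 0 1 2 * splitInd ω 0 1 4 with hY
  have hY0 : ∀ ω, 0 ≤ Y ω := fun ω => mul_nonneg (triInd_nonneg ..) (splitInd_nonneg ..)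
  have hY3 : Avoids 3 Y := by
    intro ω ω' h; simp [hY, triInd, splitInd, h]
  -- Without paws, vertex 3 has 0, 2 or 3 neighbours in the triangle, so their number minus 2 is
  -- nonnegative once the case 0, which is `X`, is compensated. The mean number is 3/2, below 2, and
  -- the compensation has nonpositive mean by `h1`, so `Y` has mean at most 0.
  have h2 : ev p (fun ω => Y ω * (adjInd ω 0 3 + adjInd ω 1 3 + adjInd ω 2 3 - 2)
      + 2 * (X ω * splitInd ω 0 1 4)) ≥ ev p (fun _ => 0) := by
    refine hp.ev_mono fun ω hω => ?_
    have f1 := hp.paw_free h hω 0 1 2 3 (by decide)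
    have f2 := hp.paw_free h hω 1 0 2 3 (by decide)
    have f3 := hp.paw_free h hω 2 0 1 3 (by decide)
    have : Y ω * (adjInd ω 0 3 + adjInd ω 1 3 + adjInd ω 2 3 - 2) + 2 * (X ω * splitInd ω 0 1 4)
        = splitInd ω 0 1 4 * (triInd ω 0 1 2 * (adjInd ω 0 3 + adjInd ω 1 3 + adjInd ω 2 3 - 2
        + 2 * ((1 - adjInd ω 0 3) * (1 - adjInd ω 1 3) * (1 - adjInd ω 2 3)))) := by
      simp only [hX, hY]; ring
    rw [this]
    refine mul_nonneg (splitInd_nonneg ..) ?_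
    by_cases g : ω.Adj 0 1 ∧ ω.Adj 0 2 ∧ ω.Adj 1 2
    · obtain ⟨g1, g2, g3⟩ := g
      refine mul_nonneg (triInd_nonneg ..) ?_
      by_cases g4 : ω.Adj 0 3 <;> by_cases g5 : ω.Adj 1 3 <;> by_cases g6 : ω.Adj 2 3 <;>
        simp [g1, g2, g3, g1.symm, g2.symm, g3.symm, g4, g5, g6, adjInd] at f1 f2 f3 ⊢ <;> norm_num
    · have : triInd ω 0 1 2 = 0 := by
        simp only [triInd, mul_eq_zero, adjInd_eq_zero]; tauto
      rw [this, zero_mul]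
  have e : (fun ω => Y ω * (adjInd ω 0 3 + adjInd ω 1 3 + adjInd ω 2 3 - 2)
      + 2 * (X ω * splitInd ω 0 1 4)) = (fun ω => Y ω * adjInd ω 0 3) + (fun ω => Y ω * adjInd ω 1 3)
      + (fun ω => Y ω * adjInd ω 2 3) - (2 : ℝ) • Y
      + (2 : ℝ) • (fun ω => X ω * splitInd ω 0 1 4) := by
    funext ω; simp; ring
  rw [hp.ev_const, e, map_add, map_sub, map_add, map_add, map_smul, map_smul,
    hp.ev_mul_adjInd Y (by decide) hY3, hp.ev_mul_adjInd Y (by decide) hY3,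
    hp.ev_mul_adjInd Y (by decide) hY3] at h2
  simp only [smul_eq_mul] at h2
  have h3 := hp.comap (Equiv.swap 3 4) (fun ω => triInd ω 0 1 2 * splitInd ω 0 1 3)
  have h4 : (fun ω : SimpleGraph (Fin 6) => triInd (ω.comap (Equiv.swap (3 : Fin 6) 4)) 0 1 2 *
      splitInd (ω.comap (Equiv.swap (3 : Fin 6) 4)) 0 1 3) = Y := by
    funext ω
    simp only [triInd, splitInd, adjInd_comap, hY]
    rfl
  rw [h4] at h3
  linarith

end IsQuasiRegular

namespace IsQuasiRegular

variable {p : SimpleGraph (Fin 6) → ℝ}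

/-- In the absence of induced diamonds, adjacent vertices of a triangle are twins. -/
lemma split_of_diamond_free (hp : IsQuasiRegular p)
    (h : ev p (fun ω => diamondInd ω 0 1 2 3) ≤ 0) :
    ev p (fun ω => triInd ω 0 1 2 * splitInd ω 0 1 3) ≤ 0 := by
  set X : SimpleGraph (Fin 6) → ℝ := fun ω => triInd ω 0 1 2 *
    (adjInd ω 0 3 * adjInd ω 1 3 * adjInd ω 2 3) with hX
  set Q : SimpleGraph (Fin 6) → ℝ := fun ω => adjInd ω 0 5 * adjInd ω 1 5 * adjInd ω 2 5 with hQ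
  have hX0 : ∀ ω, 0 ≤ X ω := fun ω => mul_nonneg (triInd_nonneg ..) (mul_nonneg (mul_nonneg
    (adjInd_nonneg ..) (adjInd_nonneg ..)) (adjInd_nonneg ..))
  have hX5 : Avoids 5 X := by
    intro ω ω' h; simp [hX, triInd, h]
  have hQ0 : ∀ ω, 0 ≤ Q ω := fun ω => mul_nonneg (mul_nonneg
    (adjInd_nonneg ..) (adjInd_nonneg ..)) (adjInd_nonneg ..)
  have hQ1 : ∀ ω, Q ω ≤ adjInd ω 0 5 ∧ Q ω ≤ adjInd ω 1 5 ∧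
      splitInd ω 0 1 5 ≤ adjInd ω 0 5 + adjInd ω 1 5 - 2 * Q ω := by
    intro ω
    simp only [hQ, splitInd]
    rcases adjInd_eq_zero_or_one ω 0 5 with h1 | h1 <;>
    rcases adjInd_eq_zero_or_one ω 1 5 with h2 | h2 <;>
    rcases adjInd_eq_zero_or_one ω 2 5 with h3 | h3 <;>
    simp only [h1, h2, h3] <;> norm_num
  set F : SimpleGraph (Fin 6) → ℝ := fun ω => X ω * (1 - Q ω) * adjInd ω 3 5 with hF
  have hF0 : ∀ ω, 0 ≤ F ω := fun ω => mul_nonneg (mul_nonneg (hX0 ω)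
    (by linarith [(hQ1 ω).1, adjInd_le_one ω 0 5])) (adjInd_nonneg ..)
  have hF4 : Avoids 4 F := by
    intro ω ω' h; simp [hF, hX, hQ, triInd, h]
  -- Take a second copy 4 of vertex 3. Both complete the triangle to a 4-clique, so without diamonds
  -- 3 and 4 are adjacent. A vertex 5 adjacent to both is then adjacent to 0, 1 and 2, contradicting
  -- the factor `1 - Q`. The product of the two copies vanishes, and Cauchy-Schwarz kills `F`.
  have hFF : ev p F ≤ 0 := by
    have h1 := hp.sq_ev_le F (i := 3) (j := 4) (by decide) hF4
    have h2 : ev p (fun ω => F ω * F (ω.comap (Equiv.swap 3 4))) ≤ ev p (fun _ => 0) := by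
      refine hp.ev_mono fun ω hω => le_of_eq ?_
      by_contra hz
      have s3 : Equiv.swap (3 : Fin 6) 4 3 = 4 := by decide
      have s0 : Equiv.swap (3 : Fin 6) 4 0 = 0 := by decide
      have s1 : Equiv.swap (3 : Fin 6) 4 1 = 1 := by decide
      have s2 : Equiv.swap (3 : Fin 6) 4 2 = 2 := by decide
      have s5 : Equiv.swap (3 : Fin 6) 4 5 = 5 := by decide
      simp only [hF, hX, triInd, adjInd_comap, s0, s1, s2, s3, s5, mul_eq_zero, adjInd_eq_zero,
        not_or, not_not] at hz
      obtain ⟨⟨⟨⟨⟨⟨h01, h02⟩, h12⟩, ⟨h03, h13⟩, h23⟩, hn⟩, h35⟩,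
        ⟨⟨-, ⟨h04, h14⟩, h24⟩, -⟩, h45⟩ := hz
      have h34 := hp.diamond_free h hω 0 1 3 4 (by decide) h01 h03 h13 h04 h14
      have h05 := hp.diamond_free h hω 3 4 0 5 (by decide) h34 h03.symm h04.symm h35 h45
      have h15 := hp.diamond_free h hω 3 4 1 5 (by decide) h34 h13.symm h14.symm h35 h45
      have h25 := hp.diamond_free h hω 3 4 2 5 (by decide) h34 h23.symm h24.symm h35 h45
      exact hn (by simp [hQ, adjInd, h05, h15, h25])
    rw [hp.ev_const] at h2
    nlinarith [hp.ev_nonneg hF0]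
  -- On a 4-clique, N(3) coincides with the common neighbourhood of 0, 1, 2: one inclusion is `F =
  -- 0`, the other is diamond-freeness. So the common neighbourhood has measure 1/2.
  have hXQ : ev p (fun ω => X ω * Q ω) = ev p X / 2 := by
    rw [← hp.ev_mul_adjInd X (i := 3) (by decide) hX5]
    refine hp.ev_congr fun ω hω => ?_
    have h1 := hp.eq_zero_of_ev_le_zero hF0 hFF ω hω
    have h2 : X ω * Q ω * (1 - adjInd ω 3 5) = 0 := by
      by_contra hz
      simp only [hX, hQ, triInd, mul_eq_zero, adjInd_eq_zero, one_sub_adjInd_eq_zero, not_or,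
        not_not] at hz
      obtain ⟨⟨⟨⟨⟨h01, h02⟩, h12⟩, ⟨h03, h13⟩, h23⟩, ⟨h05, h15⟩, h25⟩, h35⟩ := hz
      exact h35 (hp.diamond_free h hω 0 1 3 5 (by decide) h01 h03 h13 h05 h15)
    simp only [hF] at h1
    linear_combination h2 - h1
  -- N(0) and N(1) have measure 1/2 and contain a common set of measure 1/2, so they agree.
  have hXS : ev p (fun ω => X ω * splitInd ω 0 1 5) ≤ 0 := by
    have h1 : ev p (fun ω => X ω * splitInd ω 0 1 5) ≤
        ev p ((fun ω => X ω * adjInd ω 0 5) + (fun ω => X ω * adjInd ω 1 5)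
          - (2 : ℝ) • fun ω => X ω * Q ω) := by
      refine hp.ev_mono fun ω _ => ?_
      have := mul_le_mul_of_nonneg_left (hQ1 ω).2.2 (hX0 ω)
      simp only [Pi.add_apply, Pi.sub_apply, Pi.smul_apply, smul_eq_mul]
      linarith
    rw [map_sub, map_add, map_smul, hXQ, hp.ev_mul_adjInd X (by decide) hX5,
      hp.ev_mul_adjInd X (by decide) hX5, smul_eq_mul] at h1
    linarith
  set Y : SimpleGraph (Fin 6) → ℝ := fun ω => triInd ω 0 1 2 * splitInd ω 0 1 5 with hY
  have hY3 : Avoids 3 Y := by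
    intro ω ω' h; simp [hY, triInd, splitInd, h]
  -- Without diamonds, vertex 3 has 0, 1 or 3 neighbours in the triangle. The mean 3/2 exceeds 1,
  -- and the excess can only come from the case 3, which is `X` and contributes nothing by `hXS`.
  have h2 : ev p (fun ω => Y ω * (adjInd ω 0 3 + adjInd ω 1 3 + adjInd ω 2 3 - 1)
      - 2 * (X ω * splitInd ω 0 1 5)) ≤ ev p (fun _ => 0) := by
    refine hp.ev_mono fun ω hω => ?_
    have f1 := hp.diamond_free h hω 0 1 2 3 (by decide)
    have f2 := hp.diamond_free h hω 0 2 1 3 (by decide)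
    have f3 := hp.diamond_free h hω 1 2 0 3 (by decide)
    have : Y ω * (adjInd ω 0 3 + adjInd ω 1 3 + adjInd ω 2 3 - 1) - 2 * (X ω * splitInd ω 0 1 5)
        = - (splitInd ω 0 1 5 * (triInd ω 0 1 2 * (1 - adjInd ω 0 3 - adjInd ω 1 3 - adjInd ω 2 3
        + 2 * (adjInd ω 0 3 * adjInd ω 1 3 * adjInd ω 2 3)))) := by
      simp only [hX, hY]; ring
    rw [this, neg_nonpos]
    refine mul_nonneg (splitInd_nonneg ..) ?_
    by_cases g : ω.Adj 0 1 ∧ ω.Adj 0 2 ∧ ω.Adj 1 2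
    · obtain ⟨g1, g2, g3⟩ := g
      refine mul_nonneg (triInd_nonneg ..) ?_
      by_cases g4 : ω.Adj 0 3 <;> by_cases g5 : ω.Adj 1 3 <;> by_cases g6 : ω.Adj 2 3 <;>
        simp [g1, g2, g3, g1.symm, g2.symm, g3.symm, g4, g5, g6, adjInd] at f1 f2 f3 ⊢
      norm_num
    · have : triInd ω 0 1 2 = 0 := by
        simp only [triInd, mul_eq_zero, adjInd_eq_zero]; tauto
      rw [this, zero_mul]
  have e : (fun ω => Y ω * (adjInd ω 0 3 + adjInd ω 1 3 + adjInd ω 2 3 - 1)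
      - 2 * (X ω * splitInd ω 0 1 5)) = (fun ω => Y ω * adjInd ω 0 3) + (fun ω => Y ω * adjInd ω 1 3)
      + (fun ω => Y ω * adjInd ω 2 3) - Y
      - (2 : ℝ) • (fun ω => X ω * splitInd ω 0 1 5) := by
    funext ω; simp; ring
  rw [hp.ev_const, e, map_sub, map_sub, map_add, map_add, map_smul,
    hp.ev_mul_adjInd Y (by decide) hY3, hp.ev_mul_adjInd Y (by decide) hY3,
    hp.ev_mul_adjInd Y (by decide) hY3] at h2
  simp only [smul_eq_mul] at h2
  have h3 := hp.comap (Equiv.swap 3 5) (fun ω => triInd ω 0 1 2 * splitInd ω 0 1 3)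
  have h4 : (fun ω : SimpleGraph (Fin 6) => triInd (ω.comap (Equiv.swap (3 : Fin 6) 5)) 0 1 2 *
      splitInd (ω.comap (Equiv.swap (3 : Fin 6) 5)) 0 1 3) = Y := by
    funext ω
    simp only [triInd, splitInd, adjInd_comap, hY]
    rfl
  rw [h4] at h3
  linarith

/-- The adjacent vertices of a triangle are not almost surely twins. -/
lemma split_pos (hp : IsQuasiRegular p) :
    0 < ev p (fun ω => triInd ω 0 1 2 * splitInd ω 0 1 3) := by
  by_contra! h
  -- A neighbour `a` of 0 is also a neighbour of its twin 1, so `0 a 1` is again a triangle and `a`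
  -- is a twin of 0. Hence N(0) is a clique with no edges leaving it except to 0.
  have hadj : ∀ ω, 0 < p ω → ∀ a b : Fin 6, Function.Injective ![0, 1, 2, a] →
      Function.Injective ![0, a, 1, b] → ω.Adj 0 1 → ω.Adj 0 2 → ω.Adj 1 2 → ω.Adj 0 a →
      (ω.Adj 0 b ↔ ω.Adj a b) := by
    intro ω hω a b i1 i2 h01 h02 h12 h0a
    exact hp.twins h hω 0 a 1 b i2 h0a h01 (((hp.twins h hω 0 1 2 a i1 h01 h02 h12).1 h0a).symm)
  set X : SimpleGraph (Fin 6) → ℝ := fun ω => triInd ω 0 1 2 * (1 - adjInd ω 0 3) with hX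
  have hX4 : Avoids 4 X := by
    intro ω ω' h; simp [hX, triInd, h]
  -- For 3 outside N(0), the sets N(0) and N(3) are disjoint and of measure 1/2, so together they
  -- cover everything. Thus the non-neighbours of 0 also form a clique.
  have hnon : ev p (fun ω => X ω * (1 - adjInd ω 0 4) * (1 - adjInd ω 3 4)) ≤ 0 := by
    have e : ev p (fun ω => X ω * (1 - adjInd ω 0 4) * (1 - adjInd ω 3 4)) =
        ev p (X - (fun ω => X ω * adjInd ω 0 4) - (fun ω => X ω * adjInd ω 3 4)) := by
      refine hp.ev_congr fun ω hω => ?_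
      have : X ω * adjInd ω 0 4 * adjInd ω 3 4 = 0 := by
        by_contra hz
        simp only [hX, triInd, mul_eq_zero, adjInd_eq_zero, one_sub_adjInd_eq_zero, not_or,
          not_not] at hz
        obtain ⟨⟨⟨⟨⟨h01, h02⟩, h12⟩, h03⟩, h04⟩, h34⟩ := hz
        exact h03 ((hadj ω hω 4 3 (by decide) (by decide) h01 h02 h12 h04).2 h34.symm)
      simp only [Pi.sub_apply]
      linear_combination this
    rw [e, map_sub, map_sub, hp.ev_mul_adjInd X (by decide) hX4,
      hp.ev_mul_adjInd X (by decide) hX4]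
    linarith
  -- The two-clique structure makes the signed kernel of rank one.
  have hsign : ∀ ω, 0 < p ω → triInd ω 0 1 2 ≠ 0 → ∀ a b : Fin 6,
      Function.Injective ![0, 1, 2, a, b] → Function.Injective ![0, 1, 2, a] →
      Function.Injective ![0, 1, 2, b] → Function.Injective ![0, a, 1, b] →
      Function.Injective ![0, b, 1, a] →
      adjSign ω a b = adjSign ω 0 a * adjSign ω 0 b := by
    intro ω hω hT a b i1 i2 i3 i4 i5
    have h1 := hp.eq_zero_of_injective ![0, 1, 2, 3, 4] (by decide)
      (fun ω => triInd ω 0 1 2 * (1 - adjInd ω 0 3) * (1 - adjInd ω 0 4) * (1 - adjInd ω 3 4))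
      (fun ω => mul_nonneg (mul_nonneg (mul_nonneg (triInd_nonneg ..)
        (one_sub_adjInd_nonneg ..)) (one_sub_adjInd_nonneg ..)) (one_sub_adjInd_nonneg ..))
      (by simpa [triInd, adjInd_comap, hX] using hnon) ![0, 1, 2, a, b] i1 ω hω
    simp only [triInd, adjInd_comap, Matrix.cons_val, mul_eq_zero, adjInd_eq_zero,
      one_sub_adjInd_eq_zero] at h1
    simp only [triInd, ne_eq, mul_eq_zero, adjInd_eq_zero, not_or, not_not] at hT
    obtain ⟨⟨h01, h02⟩, h12⟩ := hT
    have h2 := hadj ω hω a b i2 i4 h01 h02 h12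
    have h3 := hadj ω hω b a i3 i5 h01 h02 h12
    rw [ω.adj_comm b a] at h3
    by_cases h0a : ω.Adj 0 a <;> by_cases h0b : ω.Adj 0 b <;> by_cases hab : ω.Adj a b <;>
      simp [h01, h02, h12, h0a, h0b, hab, adjSign, adjInd] at h1 h2 h3 ⊢ <;> norm_num
  -- By `hsign` the signed triangle on 3, 4, 5 equals 1 whenever 0, 1, 2 is a triangle, yet its mean
  -- on that event of probability 1/8 must be 0. Two disjoint triples are needed, hence six sampled
  -- vertices.
  have h1 := hp.triangle (fun ω => triInd ω 0 1 2) 3 4 5 (by decide) (by decide) (by decide)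
    (by intro ω ω' h; simp [triInd, h]) (by intro ω ω' h; simp [triInd, h])
    (by intro ω ω' h; simp [triInd, h])
  have h2 : ev p (fun ω => triInd ω 0 1 2 * (adjSign ω 3 4 * adjSign ω 4 5 * adjSign ω 3 5)) =
      ev p (fun ω => triInd ω 0 1 2) := by
    refine hp.ev_congr fun ω hω => ?_
    by_cases hT : triInd ω 0 1 2 = 0
    · rw [hT, zero_mul]
    rw [hsign ω hω hT 3 4 (by decide) (by decide) (by decide) (by decide) (by decide),
      hsign ω hω hT 4 5 (by decide) (by decide) (by decide) (by decide) (by decide),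
      hsign ω hω hT 3 5 (by decide) (by decide) (by decide) (by decide) (by decide)]
    have : adjSign ω 0 3 * adjSign ω 0 4 * (adjSign ω 0 4 * adjSign ω 0 5) *
        (adjSign ω 0 3 * adjSign ω 0 5) = (adjSign ω 0 3 * adjSign ω 0 3) *
        (adjSign ω 0 4 * adjSign ω 0 4) * (adjSign ω 0 5 * adjSign ω 0 5) := by ring
    rw [this, adjSign_mul_self, adjSign_mul_self, adjSign_mul_self]
    ring
  rw [h1, hp.ev_triInd] at h2
  norm_num at h2

lemma paw_pos (hp : IsQuasiRegular p) : 0 < ev p (fun ω => pawInd ω 0 1 2 3) :=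
  lt_of_not_ge fun h => (hp.split_of_paw_free h).not_gt hp.split_pos

lemma diamond_pos (hp : IsQuasiRegular p) : 0 < ev p (fun ω => diamondInd ω 0 1 2 3) :=
  lt_of_not_ge fun h => (hp.split_of_diamond_free h).not_gt hp.split_pos

end IsQuasiRegular

/-! ### Symmetry under complementation -/

lemma ev_comp_equiv {α : Type*} [Finite α] (σ : α ≃ α) (p f : α → ℝ) :
    ev (fun a => p (σ a)) f = ev p (fun a => f (σ.symm a)) := by
  have := Fintype.ofFinite α
  rw [ev_apply, ev_apply]
  exact Fintype.sum_equiv σ _ _ fun a => by simp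

/-- Complementation as a permutation of the graphs on a vertex set. -/
def complEquiv (V : Type*) : SimpleGraph V ≃ SimpleGraph V where
  toFun := compl
  invFun := compl
  left_inv := compl_compl
  right_inv := compl_compl

lemma Avoids.compl {W : Type*} {j : W} {f : SimpleGraph W → ℝ} (hf : Avoids j f) :
    Avoids j (fun ω => f ωᶜ) := by
  intro ω ω' h
  refine hf _ _ fun a b ha hb => ?_
  by_cases hab : a = b
  · subst hab; simp [adjInd]
  · rw [adjInd_compl _ hab, adjInd_compl _ hab, h a b ha hb]

lemma compl_comap_perm {W : Type*} (ω : SimpleGraph W) (σ : Equiv.Perm W) :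
    (ω.comap σ)ᶜ = ωᶜ.comap σ := by
  ext a b
  simp

namespace IsQuasiRegular

variable {p : SimpleGraph (Fin 6) → ℝ}

lemma ev_compl (p f : SimpleGraph (Fin 6) → ℝ) :
    ev (fun ω => p ωᶜ) f = ev p (fun ω => f ωᶜ) :=
  ev_comp_equiv (complEquiv _) p f

/-- Complementation flips the sign of every pair of distinct vertices, so the vanishing conditions,
which involve one or three signs, survive. This transfers paw and diamond positivity to the
complementary graphs. -/
lemma compl (hp : IsQuasiRegular p) : IsQuasiRegular (fun ω => p ωᶜ) where
  nonneg ω := hp.nonneg _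
  ev_one := by rw [ev_compl, hp.ev_one]
  comap σ f := by
    rw [ev_compl, ev_compl, ← hp.comap σ (fun ω => f ωᶜ)]
    simp only [compl_comap_perm]
  regular f i j hij hf := by
    rw [ev_compl]
    have h := hp.regular _ i j hij hf.compl
    have e : (fun ω : SimpleGraph (Fin 6) => f ωᶜ * adjSign ωᶜ i j) =
        (-1 : ℝ) • fun ω => f ωᶜ * adjSign ω i j := by
      funext ω; simp [adjSign_compl ω hij]
    rw [e, map_smul, h, smul_zero]
  triangle f i j k hij hjk hik hi hj hk := by
    rw [ev_compl]
    have h := hp.triangle _ i j k hij hjk hik hi.compl hj.compl hk.compl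
    have e : (fun ω : SimpleGraph (Fin 6) => f ωᶜ * (adjSign ωᶜ i j * adjSign ωᶜ j k *
        adjSign ωᶜ i k)) = (-1 : ℝ) • fun ω => f ωᶜ * (adjSign ω i j * adjSign ω j k *
        adjSign ω i k) := by
      funext ω; simp [adjSign_compl ω hij, adjSign_compl ω hjk, adjSign_compl ω hik]
    rw [e, map_smul, h, smul_zero]
  gram h f i j hij hh hi hj hf := by
    rw [ev_compl]
    have := hp.gram (fun ω => h ωᶜ) (fun ω => f ωᶜ) i j hij (fun ω => hh _) hi.compl hj.compl
      hf.compl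
    simpa only [compl_comap_perm] using this

/-! ### Four-vertex densities in terms of three signed densities -/

lemma ev_relabel (hp : IsQuasiRegular p) {n : ℕ} (ι κ : Fin n → Fin 6)
    (hι : Function.Injective ι) (hκ : Function.Injective κ) (f : SimpleGraph (Fin n) → ℝ) :
    ev p (fun ω => f (ω.comap κ)) = ev p (fun ω => f (ω.comap ι)) := by
  obtain ⟨σ, hσ⟩ := Equiv.Perm.exists_extending_pair ι κ hι hκ
  rw [← hp.comap σ (fun ω => f (ω.comap ι))]
  congr 1
  funext ω
  rw [SimpleGraph.comap_comap]
  congr 2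
  funext i; exact (hσ i).symm

/-- Homomorphism density of the 4-cycle in the signed kernel. -/
noncomputable def cycleDensity (p : SimpleGraph (Fin 6) → ℝ) : ℝ :=
  ev p (fun ω => adjSign ω 0 2 * adjSign ω 1 2 * (adjSign ω 0 3 * adjSign ω 1 3))

/-- Homomorphism density of `K₄` minus an edge in the signed kernel. -/
noncomputable def diamondDensity (p : SimpleGraph (Fin 6) → ℝ) : ℝ :=
  ev p (fun ω => adjSign ω 0 1 * (adjSign ω 0 2 * adjSign ω 1 2 *
    (adjSign ω 0 3 * adjSign ω 1 3)))

/-- Homomorphism density of `K₄` in the signed kernel. -/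
noncomputable def cliqueDensity (p : SimpleGraph (Fin 6) → ℝ) : ℝ :=
  ev p (fun ω => adjSign ω 2 3 * (adjSign ω 0 1 * (adjSign ω 0 2 * adjSign ω 1 2 *
    (adjSign ω 0 3 * adjSign ω 1 3))))

lemma ev_triangle_factor (hp : IsQuasiRegular p) (a b d : ℝ) :
    ev p (fun ω => (1 + a * adjSign ω 0 1) * (1 + b * adjSign ω 0 2) * (1 + d * adjSign ω 1 2))
      = 1 := by
  have e : (fun ω : SimpleGraph (Fin 6) => (1 + a * adjSign ω 0 1) * (1 + b * adjSign ω 0 2) *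
      (1 + d * adjSign ω 1 2)) =
      ((fun _ => 1) + (fun ω => a * adjSign ω 0 1) +
        (fun ω => ((1 + a * adjSign ω 0 1) * b) * adjSign ω 0 2)
      + (fun ω => ((1 + a * adjSign ω 0 1) * d) * adjSign ω 1 2)
      + (fun ω => (b * d * adjSign ω 0 2) * adjSign ω 2 1)
      + (fun ω => (a * b * d) * (adjSign ω 0 1 * adjSign ω 1 2 * adjSign ω 0 2))) := by
    funext ω
    simp [adjSign_comm ω 2 1]
    ring
  rw [e, map_add, map_add, map_add, map_add, map_add, hp.ev_one,
    hp.regular (fun _ => a) 0 1 (by decide) (fun _ _ _ => rfl),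
    hp.regular (fun ω => (1 + a * adjSign ω 0 1) * b) 0 2 (by decide) (by
      intro ω ω' h; simp [adjSign, h]),
    hp.regular (fun ω => (1 + a * adjSign ω 0 1) * d) 1 2 (by decide) (by
      intro ω ω' h; simp [adjSign, h]),
    hp.regular (fun ω => b * d * adjSign ω 0 2) 2 1 (by decide) (by
      intro ω ω' h; simp [adjSign, h]),
    hp.triangle (fun _ => a * b * d) 0 1 2 (by decide) (by decide) (by decide) (fun _ _ _ => rfl)
      (fun _ _ _ => rfl) (fun _ _ _ => rfl)]
  simp

/-- Given the cherry at 3, vertex 2 must carry both its edges for a term to survive. The 4-cycle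
then remains, or the diamond when the edge 01 is also chosen. -/
lemma ev_cherry_factor (hp : IsQuasiRegular p) (a b d : ℝ) :
    ev p (fun ω => (1 + a * adjSign ω 0 1) * (1 + b * adjSign ω 0 2) * (1 + d * adjSign ω 1 2)
      * (adjSign ω 0 3 * adjSign ω 1 3)) = b * d * (cycleDensity p + a * diamondDensity p) := by
  have e : (fun ω : SimpleGraph (Fin 6) => (1 + a * adjSign ω 0 1) * (1 + b * adjSign ω 0 2) *
      (1 + d * adjSign ω 1 2) * (adjSign ω 0 3 * adjSign ω 1 3)) =
      (fun ω => adjSign ω 0 3 * adjSign ω 3 1)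
      + (fun ω => a * (adjSign ω 0 1 * adjSign ω 1 3 * adjSign ω 0 3))
      + (fun ω => ((1 + a * adjSign ω 0 1) * (adjSign ω 0 3 * adjSign ω 1 3) * b) * adjSign ω 0 2)
      + (fun ω => ((1 + a * adjSign ω 0 1) * (adjSign ω 0 3 * adjSign ω 1 3) * d) * adjSign ω 1 2)
      + (b * d) • (fun ω => adjSign ω 0 2 * adjSign ω 1 2 * (adjSign ω 0 3 * adjSign ω 1 3))
      + (b * d * a) • (fun ω => adjSign ω 0 1 * (adjSign ω 0 2 * adjSign ω 1 2 *
        (adjSign ω 0 3 * adjSign ω 1 3))) := by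
    funext ω
    simp [adjSign_comm ω 3 1]
    ring
  rw [e, map_add, map_add, map_add, map_add, map_add, map_smul, map_smul,
    hp.regular (fun ω => adjSign ω 0 3) 3 1 (by decide) (by
      intro ω ω' h; simp [adjSign, h]),
    hp.triangle (fun _ => a) 0 1 3 (by decide) (by decide) (by decide) (fun _ _ _ => rfl)
      (fun _ _ _ => rfl) (fun _ _ _ => rfl),
    hp.regular (fun ω => (1 + a * adjSign ω 0 1) * (adjSign ω 0 3 * adjSign ω 1 3) * b) 0 2
      (by decide) (by intro ω ω' h; simp [adjSign, h]),
    hp.regular (fun ω => (1 + a * adjSign ω 0 1) * (adjSign ω 0 3 * adjSign ω 1 3) * d) 1 2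
      (by decide) (by intro ω ω' h; simp [adjSign, h])]
  simp only [cycleDensity, diamondDensity, smul_eq_mul]
  ring

lemma ev_diamond_perm (hp : IsQuasiRegular p) (i j k l : Fin 6)
    (hi : Function.Injective ![i, j, k, l]) :
    ev p (fun ω => adjSign ω i j * (adjSign ω i k * adjSign ω j k *
      (adjSign ω i l * adjSign ω j l))) = diamondDensity p := by
  simpa [adjSign_comap, diamondDensity] using hp.ev_relabel ![0, 1, 2, 3] ![i, j, k, l] (by decide) hi
    (fun ω => adjSign ω 0 1 * (adjSign ω 0 2 * adjSign ω 1 2 * (adjSign ω 0 3 * adjSign ω 1 3)))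

/-- With all three edges at 3 present, a term survives only if at least two edges among 0, 1, 2 are
chosen: two leave a diamond, three the 4-clique. -/
lemma ev_star_factor (hp : IsQuasiRegular p) (a b d : ℝ) :
    ev p (fun ω => (1 + a * adjSign ω 0 1) * (1 + b * adjSign ω 0 2) * (1 + d * adjSign ω 1 2)
      * (adjSign ω 0 3 * adjSign ω 1 3 * adjSign ω 2 3)) =
      (a * b + a * d + b * d) * diamondDensity p + a * b * d * cliqueDensity p := by
  have e : (fun ω : SimpleGraph (Fin 6) => (1 + a * adjSign ω 0 1) * (1 + b * adjSign ω 0 2) *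
      (1 + d * adjSign ω 1 2) * (adjSign ω 0 3 * adjSign ω 1 3 * adjSign ω 2 3)) =
      (fun ω => ((1 + d * adjSign ω 1 2) * (adjSign ω 1 3 * adjSign ω 2 3)) * adjSign ω 3 0)
      + (fun ω => (a * adjSign ω 0 1 * (adjSign ω 0 3 * adjSign ω 1 3)) * adjSign ω 3 2)
      + (fun ω => (b * adjSign ω 0 2 * (adjSign ω 0 3 * adjSign ω 2 3)) * adjSign ω 3 1)
      + (a * b) • (fun ω => adjSign ω 0 3 * (adjSign ω 0 1 * adjSign ω 3 1 *
        (adjSign ω 0 2 * adjSign ω 3 2)))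
      + (a * d) • (fun ω => adjSign ω 1 3 * (adjSign ω 1 0 * adjSign ω 3 0 *
        (adjSign ω 1 2 * adjSign ω 3 2)))
      + (b * d) • (fun ω => adjSign ω 2 3 * (adjSign ω 2 0 * adjSign ω 3 0 *
        (adjSign ω 2 1 * adjSign ω 3 1)))
      + (a * b * d) • (fun ω => adjSign ω 2 3 * (adjSign ω 0 1 * (adjSign ω 0 2 * adjSign ω 1 2 *
        (adjSign ω 0 3 * adjSign ω 1 3)))) := by
    funext ω
    simp [adjSign_comm ω 3 0, adjSign_comm ω 3 1, adjSign_comm ω 3 2, adjSign_comm ω 1 0,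
      adjSign_comm ω 2 0, adjSign_comm ω 2 1]
    ring
  rw [e, map_add, map_add, map_add, map_add, map_add, map_add, map_smul, map_smul, map_smul,
    map_smul,
    hp.regular (fun ω => (1 + d * adjSign ω 1 2) * (adjSign ω 1 3 * adjSign ω 2 3)) 3 0
      (by decide) (by intro ω ω' h; simp [adjSign, h]),
    hp.regular (fun ω => a * adjSign ω 0 1 * (adjSign ω 0 3 * adjSign ω 1 3)) 3 2
      (by decide) (by intro ω ω' h; simp [adjSign, h]),
    hp.regular (fun ω => b * adjSign ω 0 2 * (adjSign ω 0 3 * adjSign ω 2 3)) 3 1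
      (by decide) (by intro ω ω' h; simp [adjSign, h]),
    hp.ev_diamond_perm 0 3 1 2 (by decide), hp.ev_diamond_perm 1 3 0 2 (by decide),
    hp.ev_diamond_perm 2 3 0 1 (by decide)]
  simp only [cliqueDensity, smul_eq_mul]
  ring

/-- The density of a labelled four-vertex pattern, up to a factor `64`, in terms of the
densities of the 4-cycle, the diamond and the 4-clique in the signed kernel. -/
lemma ev_pattern (hp : IsQuasiRegular p) (a b c d e f : ℝ) :
    ev p (fun ω => (1 + a * adjSign ω 0 1) * (1 + b * adjSign ω 0 2) * (1 + d * adjSign ω 1 2) *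
      ((1 + c * adjSign ω 0 3) * (1 + e * adjSign ω 1 3) * (1 + f * adjSign ω 2 3))) =
    1 + (b * c * d * e + a * c * d * f + a * b * e * f) * cycleDensity p +
      (b * c * d * e * f + a * c * d * e * f + a * b * d * e * f + a * b * c * e * f +
        a * b * c * d * f + a * b * c * d * e) * diamondDensity p +
      a * b * c * d * e * f * cliqueDensity p := by
  set A : ℝ → ℝ → ℝ → SimpleGraph (Fin 6) → ℝ := fun a b d ω =>
    (1 + a * adjSign ω 0 1) * (1 + b * adjSign ω 0 2) * (1 + d * adjSign ω 1 2) with hA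
  have hA3 : Avoids 3 (A a b d) := by
    intro ω ω' h; simp [hA, adjSign, h]
  -- Sort by the edges chosen at vertex 3. The cherries ending in 0, 2 and in 1, 2 are brought to
  -- the form with ends 0, 1 by a transposition, which permutes `a`, `b`, `d` accordingly.
  have e1 : (fun ω : SimpleGraph (Fin 6) => (1 + a * adjSign ω 0 1) * (1 + b * adjSign ω 0 2) *
      (1 + d * adjSign ω 1 2) * ((1 + c * adjSign ω 0 3) * (1 + e * adjSign ω 1 3) *
      (1 + f * adjSign ω 2 3))) =
      A a b d + c • (fun ω => A a b d ω * adjSign ω 0 3) + e • (fun ω => A a b d ω * adjSign ω 1 3)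
      + f • (fun ω => A a b d ω * adjSign ω 2 3)
      + (c * e) • (fun ω => A a b d ω * (adjSign ω 0 3 * adjSign ω 1 3))
      + (c * f) • (fun ω => A b a d ((ω.comap (Equiv.swap 1 2))) *
        (adjSign (ω.comap (Equiv.swap 1 2)) 0 3 * adjSign (ω.comap (Equiv.swap 1 2)) 1 3))
      + (e * f) • (fun ω => A d b a ((ω.comap (Equiv.swap 0 2))) *
        (adjSign (ω.comap (Equiv.swap 0 2)) 0 3 * adjSign (ω.comap (Equiv.swap 0 2)) 1 3))
      + (c * e * f) • (fun ω => A a b d ω * (adjSign ω 0 3 * adjSign ω 1 3 * adjSign ω 2 3)) := by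
    have s1 : Equiv.swap (1 : Fin 6) 2 3 = 3 := by decide
    have s2 : Equiv.swap (1 : Fin 6) 2 0 = 0 := by decide
    have s3 : Equiv.swap (0 : Fin 6) 2 3 = 3 := by decide
    have s4 : Equiv.swap (0 : Fin 6) 2 1 = 1 := by decide
    funext ω
    simp [hA, adjSign_comap, s1, s2, s3, s4, adjSign_comm ω 2 1, adjSign_comm ω 1 0,
      adjSign_comm ω 2 0]
    ring
  rw [e1, map_add, map_add, map_add, map_add, map_add, map_add, map_add, map_smul, map_smul,
    map_smul, map_smul, map_smul, map_smul, map_smul,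
    hp.comap (Equiv.swap 1 2) (fun ω => A b a d ω * (adjSign ω 0 3 * adjSign ω 1 3)),
    hp.comap (Equiv.swap 0 2) (fun ω => A d b a ω * (adjSign ω 0 3 * adjSign ω 1 3)),
    hp.regular _ 0 3 (by decide) hA3, hp.regular _ 1 3 (by decide) hA3,
    hp.regular _ 2 3 (by decide) hA3, hp.ev_triangle_factor, hp.ev_cherry_factor,
    hp.ev_cherry_factor, hp.ev_cherry_factor, hp.ev_star_factor]
  simp only [smul_eq_mul]
  ring

/-- This is the mean of the squared signed codegree of 0 and 1 against the weight `1 + s * adjSign ω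
0 1`, which is nonnegative. -/
lemma cycleDensity_add_diamondDensity_nonneg (hp : IsQuasiRegular p) (s : ℝ) (hs : |s| = 1) :
    0 ≤ cycleDensity p + s * diamondDensity p := by
  have h := hp.gram (fun ω => 1 + s * adjSign ω 0 1) (fun ω => adjSign ω 0 2 * adjSign ω 1 2) 2 3
    (by decide) (fun ω => by
      have := neg_abs_le (s * adjSign ω 0 1)
      rw [abs_mul, hs, abs_adjSign] at this
      linarith)
    (by intro ω ω' h; simp [adjSign, h]) (by intro ω ω' h; simp [adjSign, h])
    (by intro ω ω' h; simp [adjSign, h])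
  have s2 : Equiv.swap (2 : Fin 6) 3 0 = 0 := by decide
  have s1 : Equiv.swap (2 : Fin 6) 3 1 = 1 := by decide
  have e : (fun ω : SimpleGraph (Fin 6) => (1 + s * adjSign ω 0 1) *
      (adjSign ω 0 2 * adjSign ω 1 2 *
      (adjSign (ω.comap (Equiv.swap (2 : Fin 6) 3)) 0 2 *
        adjSign (ω.comap (Equiv.swap (2 : Fin 6) 3)) 1 2))) =
      (fun ω => adjSign ω 0 2 * adjSign ω 1 2 * (adjSign ω 0 3 * adjSign ω 1 3)) +
      s • (fun ω => adjSign ω 0 1 * (adjSign ω 0 2 * adjSign ω 1 2 *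
        (adjSign ω 0 3 * adjSign ω 1 3))) := by
    funext ω
    simp [adjSign_comap, s1, s2]
    ring
  rw [e, map_add, map_smul] at h
  exact h

/-- Every labelled four-vertex pattern has positive density. -/
theorem pattern_pos (hp : IsQuasiRegular p) (H : SimpleGraph (Fin 4)) :
    0 < ev p (fun ω => (1 + adjSign H 0 1 * adjSign ω 0 1) * (1 + adjSign H 0 2 * adjSign ω 0 2) *
      (1 + adjSign H 1 2 * adjSign ω 1 2) * ((1 + adjSign H 0 3 * adjSign ω 0 3) *
      (1 + adjSign H 1 3 * adjSign ω 1 3) * (1 + adjSign H 2 3 * adjSign ω 2 3))) := by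
  have h1 := hp.cycleDensity_add_diamondDensity_nonneg 1 (by simp)
  have h2 := hp.cycleDensity_add_diamondDensity_nonneg (-1) (by simp)
  have hpaw : 0 < 1 - cycleDensity p + 2 * diamondDensity p + cliqueDensity p := by
    have h := hp.paw_pos
    have e : (fun ω : SimpleGraph (Fin 6) => pawInd ω 0 1 2 3) = (1 / 64 : ℝ) • (fun ω =>
        (1 + 1 * adjSign ω 0 1) * (1 + 1 * adjSign ω 0 2) * (1 + 1 * adjSign ω 1 2) *
        ((1 + 1 * adjSign ω 0 3) * (1 + (-1) * adjSign ω 1 3) * (1 + (-1) * adjSign ω 2 3))) := by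
      funext ω; simp [pawInd, triInd, adjSign]; ring
    rw [e, map_smul, hp.ev_pattern, smul_eq_mul] at h
    linarith
  have hdia : 0 < 1 - cycleDensity p - 4 * diamondDensity p - cliqueDensity p := by
    have h := hp.diamond_pos
    have e : (fun ω : SimpleGraph (Fin 6) => diamondInd ω 0 1 2 3) = (1 / 64 : ℝ) • (fun ω =>
        (1 + 1 * adjSign ω 0 1) * (1 + 1 * adjSign ω 0 2) * (1 + 1 * adjSign ω 1 2) *
        ((1 + 1 * adjSign ω 0 3) * (1 + 1 * adjSign ω 1 3) * (1 + (-1) * adjSign ω 2 3))) := by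
      funext ω; simp [diamondInd, triInd, adjSign]; ring
    rw [e, map_smul, hp.ev_pattern, smul_eq_mul] at h
    linarith
  have hpaw' : 0 < 1 - cycleDensity p - 2 * diamondDensity p + cliqueDensity p := by
    have h := hp.compl.paw_pos
    have e : (fun ω : SimpleGraph (Fin 6) => pawInd ωᶜ 0 1 2 3) = (1 / 64 : ℝ) • (fun ω =>
        (1 + (-1) * adjSign ω 0 1) * (1 + (-1) * adjSign ω 0 2) * (1 + (-1) * adjSign ω 1 2) *
        ((1 + (-1) * adjSign ω 0 3) * (1 + 1 * adjSign ω 1 3) * (1 + 1 * adjSign ω 2 3))) := by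
      funext ω; simp [pawInd, triInd, adjSign, adjInd_compl]; ring
    rw [ev_compl, e, map_smul, hp.ev_pattern, smul_eq_mul] at h
    linarith
  have hdia' : 0 < 1 - cycleDensity p + 4 * diamondDensity p - cliqueDensity p := by
    have h := hp.compl.diamond_pos
    have e : (fun ω : SimpleGraph (Fin 6) => diamondInd ωᶜ 0 1 2 3) = (1 / 64 : ℝ) • (fun ω =>
        (1 + (-1) * adjSign ω 0 1) * (1 + (-1) * adjSign ω 0 2) * (1 + (-1) * adjSign ω 1 2) *
        ((1 + (-1) * adjSign ω 0 3) * (1 + (-1) * adjSign ω 1 3) * (1 + 1 * adjSign ω 2 3))) := by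
      funext ω; simp [diamondInd, triInd, adjSign, adjInd_compl]; ring
    rw [ev_compl, e, map_smul, hp.ev_pattern, smul_eq_mul] at h
    linarith
  have hs : ∀ a b : Fin 4, adjSign H a b = 1 ∨ adjSign H a b = -1 := fun a b =>
    (abs_eq zero_le_one).1 (abs_adjSign H a b)
  rw [hp.ev_pattern]
  generalize cycleDensity p = C at *
  generalize diamondDensity p = D at *
  generalize cliqueDensity p = K at *
  -- Examples of the combinations: the 4-clique is the paw plus 4(C + D), the 4-cycle is the paw
  -- plus 4C, the path is half the sum of the diamond and its complement, and the claw is the path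
  -- plus 4C.
  rcases hs 0 1 with a | a <;> rcases hs 0 2 with b | b <;> rcases hs 0 3 with c | c <;>
  rcases hs 1 2 with d | d <;> rcases hs 1 3 with e | e <;> rcases hs 2 3 with f | f <;>
  · rw [a, b, c, d, e, f]
    linarith

end IsQuasiRegular

/-! ### Sampling vertices of a finite graph with replacement -/

section Sampling

variable {ι : Type*} [DecidableEq ι] {V : Type*}

lemma Avoids.comap_update {j : ι} {f : SimpleGraph ι → ℝ} (hf : Avoids j f) (G : SimpleGraph V)
    (x : ι → V) (y : V) : f (G.comap (Function.update x j y)) = f (G.comap x) := by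
  refine hf _ _ fun a b ha hb => ?_
  simp [adjInd_comap, ha, hb]

variable [Fintype ι] [Fintype V]

/-- The normalized signed degree of a vertex. -/
noncomputable def degSign (G : SimpleGraph V) (v : V) : ℝ := 𝔼 w, adjSign G v w

/-- The density of triangles in the signed kernel of a graph. -/
noncomputable def triSign (G : SimpleGraph V) : ℝ :=
  𝔼 a, 𝔼 b, 𝔼 c, adjSign G a b * adjSign G b c * adjSign G a c

/-- The expectation of a parameter on a random sample of vertices. -/
noncomputable def sample (G : SimpleGraph V) (f : SimpleGraph ι → ℝ) : ℝ :=
  𝔼 x : ι → V, f (G.comap x)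

lemma sample_comap (G : SimpleGraph V) (σ : Equiv.Perm ι) (f : SimpleGraph ι → ℝ) :
    sample G (fun ω => f (ω.comap σ)) = sample G f := by
  rw [sample, sample]
  refine Fintype.expect_equiv (Equiv.arrowCongr σ.symm (Equiv.refl V)) _ _ fun x => ?_
  rw [SimpleGraph.comap_comap]
  rfl

variable [Nonempty V]

/-- Resampling one coordinate does not change the expectation. -/
lemma expect_update (i : ι) (g : (ι → V) → ℝ) :
    𝔼 x, 𝔼 y, g (Function.update x i y) = 𝔼 x, g x := by
  -- Exchanging coordinate `i` with the fresh vertex is an involution.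
  let e : (ι → V) × V ≃ (ι → V) × V :=
    { toFun := fun q => (Function.update q.1 i q.2, q.1 i)
      invFun := fun q => (Function.update q.1 i q.2, q.1 i)
      left_inv := fun q => by simp
      right_inv := fun q => by simp }
  have h1 : 𝔼 x : ι → V, 𝔼 y : V, g (Function.update x i y) =
      𝔼 q : (ι → V) × V, g (Function.update q.1 i q.2) := by
    rw [← Finset.univ_product_univ, Finset.expect_product]
  have h2 : 𝔼 x : ι → V, 𝔼 _y : V, g x = 𝔼 q : (ι → V) × V, g q.1 := by
    rw [← Finset.univ_product_univ, Finset.expect_product]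
  rw [h1, Fintype.expect_equiv e (fun q => g (Function.update q.1 i q.2)) (fun q => g q.1)
    (fun q => rfl), ← h2]
  simp only [Fintype.expect_const]

lemma expect_coord (i : ι) (φ : V → ℝ) : 𝔼 x : ι → V, φ (x i) = 𝔼 v, φ v := by
  rw [← expect_update i]
  simp

/-- Resampling vertex `j`, which `f` does not see, averages the sign to the normalized signed degree
of vertex `i`. -/
lemma abs_sample_mul_adjSign_le (G : SimpleGraph V) (f : SimpleGraph ι → ℝ) {i j : ι} (hij : i ≠ j)
    (hf : Avoids j f) {C : ℝ} (hC : ∀ ω, |f ω| ≤ C) :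
    |sample G (fun ω => f ω * adjSign ω i j)| ≤ C * 𝔼 v, |degSign G v| := by
  have h1 : sample G (fun ω => f ω * adjSign ω i j) =
      𝔼 x : ι → V, f (G.comap x) * degSign G (x i) := by
    rw [sample, ← expect_update j]
    refine Finset.expect_congr rfl fun x _ => ?_
    simp [hf.comap_update, adjSign_comap, hij, degSign, Finset.mul_expect]
  rw [h1, ← expect_coord i (fun v => |degSign G v|), Finset.mul_expect]
  refine (Finset.abs_expect_le _ _).trans (Finset.expect_le_expect fun x _ => ?_)
  rw [abs_mul]
  exact mul_le_mul_of_nonneg_right (hC _) (abs_nonneg _)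

lemma sample_mul_triangle (G : SimpleGraph V) (f : SimpleGraph ι → ℝ) {i j k : ι} (hij : i ≠ j)
    (hjk : j ≠ k) (hik : i ≠ k) (hi : Avoids i f) (hj : Avoids j f) (hk : Avoids k f) :
    sample G (fun ω => f ω * (adjSign ω i j * adjSign ω j k * adjSign ω i k)) =
      sample G f * triSign G := by
  have h1 : sample G (fun ω => f ω * (adjSign ω i j * adjSign ω j k * adjSign ω i k)) =
      𝔼 x : ι → V, f (G.comap x) * triSign G := by
    rw [sample, ← expect_update k, ← expect_update j, ← expect_update i]
    refine Finset.expect_congr rfl fun x _ => ?_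
    simp only [triSign, Finset.mul_expect]
    refine Finset.expect_congr rfl fun a _ => Finset.expect_congr rfl fun b _ =>
      Finset.expect_congr rfl fun c _ => ?_
    rw [hk.comap_update, hj.comap_update, hi.comap_update]
    simp [adjSign_comap, hij, hjk, hik]
  rw [h1, sample, Finset.expect_mul]

/-- Given the other vertices, `i` and `j` are independent and identically distributed, so averaging
over both produces a square. -/
lemma sample_gram_nonneg (G : SimpleGraph V) (h f : SimpleGraph ι → ℝ) {i j : ι} (hij : i ≠ j)
    (hh : ∀ ω, 0 ≤ h ω) (hi : Avoids i h) (hj : Avoids j h) (hf : Avoids j f) :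
    0 ≤ sample G (fun ω => h ω * (f ω * f (ω.comap (Equiv.swap i j)))) := by
  have h1 : sample G (fun ω => h ω * (f ω * f (ω.comap (Equiv.swap i j)))) =
      𝔼 x : ι → V, h (G.comap x) * (𝔼 y, f (G.comap (Function.update x i y))) ^ 2 := by
    rw [sample, ← expect_update j, ← expect_update i]
    refine Finset.expect_congr rfl fun x _ => ?_
    rw [sq, Fintype.expect_mul_expect, Finset.mul_expect]
    refine Finset.expect_congr rfl fun y _ => ?_
    rw [Finset.mul_expect]
    refine Finset.expect_congr rfl fun z _ => ?_
    rw [hj.comap_update, hi.comap_update, hf.comap_update]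
    congr 2
    rw [SimpleGraph.comap_comap]
    refine hf _ _ fun a b ha hb => ?_
    have key : ∀ a, a ≠ j → (Function.update (Function.update x i y) j z ∘ Equiv.swap i j) a =
        Function.update x i z a := by
      intro a ha
      by_cases hai : a = i
      · subst hai; simp
      · simp [Equiv.swap_apply_of_ne_of_ne hai ha, hai, ha]
    rw [adjInd_comap, adjInd_comap, key a ha, key b hb]
  rw [h1]
  exact Finset.expect_nonneg fun x _ => mul_nonneg (hh _) (sq_nonneg _)

/-- Union bound over ordered pairs of coordinates, each colliding with probability `1 / Fintype.card
V`. -/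
lemma expect_not_injective_le (m : ℕ) :
    𝔼 x : Fin m → V, (open Classical in if Function.Injective x then (0 : ℝ) else 1) ≤
      m ^ 2 / Fintype.card V := by
  classical
  have h1 : ∀ i j : Fin m, i ≠ j → 𝔼 x : Fin m → V, (if x i = x j then (1 : ℝ) else 0) =
      1 / Fintype.card V := by
    intro i j hij
    rw [← expect_update j]
    simp [hij]
  calc _ ≤ 𝔼 x : Fin m → V, ∑ i, ∑ j, (if i ≠ j then if x i = x j then (1 : ℝ) else 0 else 0) := by
        refine Finset.expect_le_expect fun x _ => ?_
        have h0 : ∀ i j : Fin m, (0 : ℝ) ≤ if i ≠ j then if x i = x j then (1 : ℝ) else 0 else 0 := by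
          intro i j; split_ifs <;> norm_num
        split_ifs with hx
        · exact Finset.sum_nonneg fun i _ => Finset.sum_nonneg fun j _ => h0 i j
        · rw [Function.Injective] at hx
          push Not at hx
          obtain ⟨i, j, hx, hij⟩ := hx
          refine le_trans ?_ (Finset.single_le_sum (f := fun i => ∑ j, (if i ≠ j then
            if x i = x j then (1 : ℝ) else 0 else 0))
            (fun i _ => Finset.sum_nonneg fun j _ => h0 i j) (Finset.mem_univ i))
          refine le_trans ?_ (Finset.single_le_sum (fun j _ => h0 i j) (Finset.mem_univ j))
          simp [hij, hx]
    _ = ∑ i : Fin m, ∑ j : Fin m, 𝔼 x : Fin m → V,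
          (if i ≠ j then if x i = x j then (1 : ℝ) else 0 else 0) := by
        rw [Finset.expect_sum_comm]
        refine Finset.sum_congr rfl fun i _ => ?_
        rw [Finset.expect_sum_comm]
    _ ≤ ∑ i : Fin m, ∑ j : Fin m, (1 / Fintype.card V : ℝ) := by
        refine Finset.sum_le_sum fun i _ => Finset.sum_le_sum fun j _ => ?_
        by_cases hij : i = j
        · simp [hij]
        · simp only [ne_eq, hij, not_false_eq_true, if_true]
          exact (h1 i j hij).le
    _ = m ^ 2 / Fintype.card V := by
        simp; ring

/-- Induced density is at least the density of induced labelled copies. -/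
lemma expect_induced_le_density {m : ℕ} (H : SimpleGraph (Fin m)) (G : SimpleGraph V)
    (hm : m ≤ Fintype.card V) :
    𝔼 x : Fin m → V, (open Classical in if Function.Injective x ∧ G.comap x = H then (1 : ℝ) else 0)
      ≤ density H G := by
  classical
  -- Each vertex set is the image of at most `m.factorial` injective samples. Combined with
  -- `n.choose m * m.factorial ≤ n ^ m`, this gives the inequality in the needed direction.
  have hcount : (Finset.univ.filter fun x : Fin m → V => Function.Injective x ∧ G.comap x = H).card
      ≤ m.factorial * inducedCount H G := by
    rw [inducedCount, Nat.card_eq_fintype_card, Fintype.card_subtype]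
    refine Finset.card_le_mul_card_image_of_maps_to (f := fun x => Finset.univ.image x) ?_ _ ?_
    · intro x hx
      simp only [Finset.mem_filter, Finset.mem_univ, true_and] at hx ⊢
      have hS : ((Finset.univ.image x : Finset V) : Set V) = Set.range x := by simp
      rw [hS]
      refine ⟨RelIso.symm ⟨Equiv.ofInjective x hx.1, ?_⟩⟩
      intro a b
      have h2 : H.Adj a b ↔ G.Adj (x a) (x b) := by
        conv_lhs => rw [← hx.2]
        simp
      rw [h2]
      simp
    · intro S _
      rw [Finset.filter_filter]
      by_cases hne : ∃ x : Fin m → V, Function.Injective x ∧ Finset.univ.image x = S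
      · obtain ⟨x, hx, hxS⟩ := hne
        have hS : S.card = m := by
          rw [← hxS, Finset.card_image_of_injective _ hx]; simp
        have h1 : Fintype.card {x : Fin m → V // (Function.Injective x ∧ G.comap x = H) ∧
            Finset.univ.image x = S} ≤ Fintype.card (Fin m ↪ S) := by
          refine Fintype.card_le_of_injective
            (fun x => ⟨fun i => ⟨x.1 i, (Finset.ext_iff.1 x.2.2 (x.1 i)).1 (by simp)⟩, fun a b hab => ?_⟩) ?_
          · exact x.2.1.1 (by simpa using hab)
          · intro x y hxy
            ext i
            have := DFunLike.congr_fun hxy i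
            exact congrArg Subtype.val this
        rw [Fintype.card_embedding_eq, Fintype.card_coe, hS, Fintype.card_fin,
          Nat.descFactorial_self, Fintype.card_subtype] at h1
        exact h1
      · rw [Finset.filter_false_of_mem]
        · simp
        · rintro x - ⟨h1, h2⟩
          exact hne ⟨x, h1.1, h2⟩
  have hn : (0 : ℝ) < Fintype.card V := by exact_mod_cast Fintype.card_pos
  have hC : (0 : ℝ) < (Fintype.card V).choose m := by exact_mod_cast Nat.choose_pos hm
  have hC2 : ((Fintype.card V).choose m : ℝ) ≤ (Fintype.card V : ℝ) ^ m / m.factorial :=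
    Nat.choose_le_pow_div m _
  have hf : (0 : ℝ) < m.factorial := by exact_mod_cast m.factorial_pos
  rw [Fintype.expect_eq_sum_div_card, Finset.sum_boole, density, Fintype.card_fin, Fintype.card_fun,
    Fintype.card_fin]
  push_cast
  rw [div_le_div_iff₀ (by positivity) hC]
  rw [le_div_iff₀ hf] at hC2
  have hcount' : ((Finset.univ.filter fun x : Fin m → V =>
      Function.Injective x ∧ G.comap x = H).card : ℝ) ≤ m.factorial * inducedCount H G := by
    exact_mod_cast hcount
  calc _ ≤ (m.factorial * inducedCount H G : ℝ) * (Fintype.card V).choose m :=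
        mul_le_mul_of_nonneg_right hcount' hC.le
    _ = (inducedCount H G : ℝ) * ((Fintype.card V).choose m * m.factorial) := by ring
    _ ≤ _ := mul_le_mul_of_nonneg_left hC2 (Nat.cast_nonneg _)

end Sampling

/-! ### Goodman's identity and its consequences -/

/-- Goodman's identity, in terms of triangles and anti-triangles in a random triple. -/
lemma goodman {V : Type*} [Fintype V] [Nonempty V] (G : SimpleGraph V) :
    (𝔼 x : Fin 3 → V, adjInd G (x 0) (x 1) * adjInd G (x 0) (x 2) * adjInd G (x 1) (x 2)) +
    (𝔼 x : Fin 3 → V, (1 - adjInd G (x 0) (x 1)) * (1 - adjInd G (x 0) (x 2)) *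
      (1 - adjInd G (x 1) (x 2))) = 1 / 4 + 3 / 4 * 𝔼 v, degSign G v ^ 2 ∧
    (𝔼 x : Fin 3 → V, adjInd G (x 0) (x 1) * adjInd G (x 0) (x 2) * adjInd G (x 1) (x 2)) -
    (𝔼 x : Fin 3 → V, (1 - adjInd G (x 0) (x 1)) * (1 - adjInd G (x 0) (x 2)) *
      (1 - adjInd G (x 1) (x 2))) = 3 / 4 * (𝔼 v, degSign G v) + 1 / 4 * triSign G := by
  have edge : ∀ i j : Fin 3, i ≠ j → 𝔼 x : Fin 3 → V, adjSign G (x i) (x j) =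
      𝔼 v, degSign G v := by
    intro i j hij
    rw [← expect_update j, ← expect_coord i (degSign G)]
    simp [hij, degSign]
  have cherry : ∀ i j k : Fin 3, i ≠ j → i ≠ k → j ≠ k →
      𝔼 x : Fin 3 → V, adjSign G (x i) (x j) * adjSign G (x i) (x k) =
      𝔼 v, degSign G v ^ 2 := by
    intro i j k hij hik hjk
    rw [← expect_update k, ← expect_update j, ← expect_coord i (fun v => degSign G v ^ 2)]
    refine Finset.expect_congr rfl fun x _ => ?_
    rw [degSign, sq, Fintype.expect_mul_expect]
    simp [hij, hik, hjk]
  have tri : 𝔼 x : Fin 3 → V, adjSign G (x 0) (x 1) * adjSign G (x 1) (x 2) *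
      adjSign G (x 0) (x 2) = triSign G := by
    rw [← expect_update 2, ← expect_update 1, ← expect_update 0]
    simp [triSign]
  constructor
  · rw [← Finset.expect_add_distrib]
    have e : ∀ x : Fin 3 → V, adjInd G (x 0) (x 1) * adjInd G (x 0) (x 2) * adjInd G (x 1) (x 2) +
        (1 - adjInd G (x 0) (x 1)) * (1 - adjInd G (x 0) (x 2)) * (1 - adjInd G (x 1) (x 2)) =
        1 / 4 + 1 / 4 * (adjSign G (x 0) (x 1) * adjSign G (x 0) (x 2)) +
        1 / 4 * (adjSign G (x 1) (x 0) * adjSign G (x 1) (x 2)) +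
        1 / 4 * (adjSign G (x 2) (x 0) * adjSign G (x 2) (x 1)) := by
      intro x
      rw [adjSign_comm G (x 1) (x 0), adjSign_comm G (x 2) (x 0), adjSign_comm G (x 2) (x 1)]
      simp only [adjSign]; ring
    simp only [e, Finset.expect_add_distrib, ← Finset.mul_expect, Fintype.expect_const]
    rw [cherry 0 1 2 (by decide) (by decide) (by decide),
      cherry 1 0 2 (by decide) (by decide) (by decide),
      cherry 2 0 1 (by decide) (by decide) (by decide)]
    ring
  · rw [← Finset.expect_sub_distrib]
    have e : ∀ x : Fin 3 → V, adjInd G (x 0) (x 1) * adjInd G (x 0) (x 2) * adjInd G (x 1) (x 2) -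
        (1 - adjInd G (x 0) (x 1)) * (1 - adjInd G (x 0) (x 2)) * (1 - adjInd G (x 1) (x 2)) =
        1 / 4 * adjSign G (x 0) (x 1) + 1 / 4 * adjSign G (x 0) (x 2) +
        1 / 4 * adjSign G (x 1) (x 2) +
        1 / 4 * (adjSign G (x 0) (x 1) * adjSign G (x 1) (x 2) * adjSign G (x 0) (x 2)) := by
      intro x
      simp only [adjSign]; ring
    simp only [e, Finset.expect_add_distrib, ← Finset.mul_expect]
    rw [edge 0 1 (by decide), edge 0 2 (by decide), edge 1 2 (by decide), tri]
    ring

/-- A triple with a repeated vertex never counts as a triangle, so no error term appears. -/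
lemma expect_triangle_le_density {V : Type*} [Fintype V] [Nonempty V] (G : SimpleGraph V)
    (hV : 3 ≤ Fintype.card V) :
    𝔼 x : Fin 3 → V, adjInd G (x 0) (x 1) * adjInd G (x 0) (x 2) * adjInd G (x 1) (x 2) ≤
      density (⊤ : SimpleGraph (Fin 3)) G := by
  classical
  refine le_trans (Finset.expect_le_expect fun x _ => ?_) (expect_induced_le_density ⊤ G hV)
  by_cases h : G.Adj (x 0) (x 1) ∧ G.Adj (x 0) (x 2) ∧ G.Adj (x 1) (x 2)
  · obtain ⟨h1, h2, h3⟩ := h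
    have hx : ∀ i j : Fin 3, i ≠ j → G.Adj (x i) (x j) := by
      intro i j hij
      fin_cases i <;> fin_cases j <;> simp_all [h1.symm, h2.symm, h3.symm]
    rw [if_pos]
    · simp [adjInd, h1, h2, h3]
    · refine ⟨fun i j hij => by_contra fun hne => (hx i j hne).ne hij, ?_⟩
      ext i j
      simp only [SimpleGraph.comap_adj, SimpleGraph.top_adj]
      exact ⟨fun h hij => h.ne (congrArg x hij), hx i j⟩
  · have : adjInd G (x 0) (x 1) * adjInd G (x 0) (x 2) * adjInd G (x 1) (x 2) = 0 := by
      simp only [mul_eq_zero, adjInd_eq_zero]; tauto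
    rw [this]
    split_ifs <;> norm_num

/-- A repeated vertex reads as a non-edge, so repeated triples may count here. The term `9 /
Fintype.card V` pays for them. -/
lemma expect_antitriangle_le_density {V : Type*} [Fintype V] [Nonempty V] (G : SimpleGraph V)
    (hV : 3 ≤ Fintype.card V) :
    𝔼 x : Fin 3 → V, (1 - adjInd G (x 0) (x 1)) * (1 - adjInd G (x 0) (x 2)) *
      (1 - adjInd G (x 1) (x 2)) ≤
      density (⊥ : SimpleGraph (Fin 3)) G + 9 / Fintype.card V := by
  classical
  have h9 := expect_not_injective_le (V := V) 3
  norm_num at h9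
  refine le_trans ?_ (add_le_add (expect_induced_le_density ⊥ G hV) h9)
  rw [← Finset.expect_add_distrib]
  refine Finset.expect_le_expect fun x _ => ?_
  by_cases hinj : Function.Injective x
  swap
  · simp only [hinj, false_and, if_false]
    rw [zero_add]
    have := one_sub_adjInd_nonneg G (x 0) (x 2)
    have := one_sub_adjInd_nonneg G (x 1) (x 2)
    have := adjInd_nonneg G (x 0) (x 1)
    have := adjInd_nonneg G (x 0) (x 2)
    have := adjInd_nonneg G (x 1) (x 2)
    exact mul_le_one₀ (mul_le_one₀ (by linarith) (by linarith) (by linarith))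
      (by linarith) (by linarith)
  by_cases h : ¬ G.Adj (x 0) (x 1) ∧ ¬ G.Adj (x 0) (x 2) ∧ ¬ G.Adj (x 1) (x 2)
  · obtain ⟨h1, h2, h3⟩ := h
    have hx : G.comap x = ⊥ := by
      ext i j
      simp only [SimpleGraph.comap_adj, SimpleGraph.bot_adj, iff_false]
      fin_cases i <;> fin_cases j <;>
        simp [h1, h2, h3, G.adj_comm (x 1) (x 0), G.adj_comm (x 2) (x 0), G.adj_comm (x 2) (x 1)]
    simp [adjInd, h1, h2, h3, hinj, hx]
  · have : (1 - adjInd G (x 0) (x 1)) * (1 - adjInd G (x 0) (x 2)) *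
        (1 - adjInd G (x 1) (x 2)) = 0 := by
      simp only [mul_eq_zero, one_sub_adjInd_eq_zero]; tauto
    rw [this]
    split_ifs <;> norm_num

/-- If the densities of triangles and anti-triangles exceed `1/8` by little, then almost all
degrees are close to `n/2` and the signed triangle density is close to `0`. -/
lemma degSign_triSign_bound {V : Type*} [Fintype V] [Nonempty V] (G : SimpleGraph V)
    (hV : 3 ≤ Fintype.card V) {η : ℝ}
    (h0 : density (⊥ : SimpleGraph (Fin 3)) G + 9 / Fintype.card V ≤ 1 / 8 + η)
    (h3 : density (⊤ : SimpleGraph (Fin 3)) G ≤ 1 / 8 + η) :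
    (𝔼 v, |degSign G v|) ≤ √(3 * η) ∧ |triSign G| ≤ 8 * η + 3 * √(3 * η) := by
  obtain ⟨g1, g2⟩ := goodman G
  have a1 := (expect_triangle_le_density G hV).trans h3
  have a2 := (expect_antitriangle_le_density G hV).trans h0
  set A := 𝔼 x : Fin 3 → V, adjInd G (x 0) (x 1) * adjInd G (x 0) (x 2) * adjInd G (x 1) (x 2)
  set B := 𝔼 x : Fin 3 → V, (1 - adjInd G (x 0) (x 1)) * (1 - adjInd G (x 0) (x 2)) *
      (1 - adjInd G (x 1) (x 2))
  have hq : 0 ≤ 𝔼 v, degSign G v ^ 2 := Finset.expect_nonneg fun v _ => sq_nonneg _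
  have hcs : (𝔼 v, |degSign G v|) ^ 2 ≤ 𝔼 v, degSign G v ^ 2 := by
    have := Finset.expect_mul_sq_le_sq_mul_sq Finset.univ (fun v => |degSign G v|) (fun _ => 1)
    simpa using this
  -- Goodman bounds the mean square by `8 / 3 * η`, rounded up to `3 * η`.
  have hm : (𝔼 v, |degSign G v|) ≤ √(3 * η) := Real.le_sqrt_of_sq_le (by linarith)
  refine ⟨hm, ?_⟩
  have h4 : |𝔼 v, degSign G v| ≤ √(3 * η) := (Finset.abs_expect_le _ _).trans hm
  rw [abs_le] at h4 ⊢
  -- Since `A + B ≥ 1 / 4` and both are at most `1 / 8 + η`, their difference is at most `2 * η` in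
  -- absolute value.
  constructor <;> linarith [h4.1, h4.2]

/-! ### Limits of sampling distributions -/

lemma expect_comp_eq_ev {X α : Type*} [Fintype X] [Finite α] (φ : X → α) (f : α → ℝ) :
    𝔼 x, f (φ x) =
      ev (fun a => 𝔼 x, (open Classical in if φ x = a then (1 : ℝ) else 0)) f := by
  classical
  have := Fintype.ofFinite α
  rw [ev_apply]
  simp only [Finset.expect_mul]
  rw [← Finset.expect_sum_comm]
  refine Finset.expect_congr rfl fun x _ => ?_
  simp

lemma tendsto_ev {α : Type*} [Finite α] {l : Filter ℕ} {q : ℕ → α → ℝ} {p : α → ℝ}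
    (h : ∀ a, Tendsto (fun k => q k a) l (𝓝 (p a))) (f : α → ℝ) :
    Tendsto (fun k => ev (q k) f) l (𝓝 (ev p f)) := by
  have := Fintype.ofFinite α
  simp only [ev_apply]
  exact tendsto_finsetSum _ fun a _ => (h a).mul_const _

/-- Limits of random samples along an ultrafilter. -/
lemma exists_tendsto_sample {V : ℕ → Type u} [∀ k, Fintype (V k)] [∀ k, Nonempty (V k)]
    (G : ∀ k, SimpleGraph (V k)) (l : Ultrafilter ℕ) :
    ∃ p : SimpleGraph (Fin 6) → ℝ, (∀ ω, 0 ≤ p ω) ∧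
      ∀ f, Tendsto (fun k => sample (G k) f) l (𝓝 (ev p f)) := by
  classical
  set q : ℕ → SimpleGraph (Fin 6) → ℝ := fun k ω => 𝔼 x : Fin 6 → V k,
    (if (G k).comap x = ω then (1 : ℝ) else 0) with hq
  have hq01 : ∀ k ω, q k ω ∈ Set.Icc (0 : ℝ) 1 := by
    intro k ω
    constructor
    · exact Finset.expect_nonneg fun x _ => by split_ifs <;> norm_num
    · exact Finset.expect_le Finset.univ_nonempty fun x _ => by split_ifs <;> norm_num
  have hlim : ∀ ω, ∃ a ∈ Set.Icc (0 : ℝ) 1, Tendsto (fun k => q k ω) l (𝓝 a) := by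
    intro ω
    obtain ⟨a, ha, hle⟩ := isCompact_Icc.ultrafilter_le_nhds (l.map fun k => q k ω)
      (by
        simp only [le_principal_iff]
        exact Filter.Eventually.of_forall (f := (l : Filter ℕ)) fun k => hq01 k ω)
    exact ⟨a, ha, hle⟩
  choose p hp hpl using hlim
  refine ⟨p, fun ω => (hp ω).1, fun f => ?_⟩
  refine (tendsto_ev hpl f).congr fun k => ?_
  rw [sample, expect_comp_eq_ev (fun x : Fin 6 → V k => (G k).comap x) f]

lemma exists_abs_le {α : Type*} [Finite α] (f : α → ℝ) : ∃ C, ∀ a, |f a| ≤ C := by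
  obtain ⟨C, hC⟩ := (Set.finite_range fun a => |f a|).bddAbove
  exact ⟨C, fun a => hC ⟨a, rfl⟩⟩

lemma isQuasiRegular_of_tendsto {V : ℕ → Type u} [∀ k, Fintype (V k)] [∀ k, Nonempty (V k)]
    (G : ∀ k, SimpleGraph (V k)) (l : Filter ℕ) [l.NeBot]
    (hdeg : Tendsto (fun k => 𝔼 v, |degSign (G k) v|) l (𝓝 0))
    (htri : Tendsto (fun k => triSign (G k)) l (𝓝 0)) {p : SimpleGraph (Fin 6) → ℝ}
    (hp0 : ∀ ω, 0 ≤ p ω) (hp : ∀ f, Tendsto (fun k => sample (G k) f) l (𝓝 (ev p f))) :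
    IsQuasiRegular p where
  nonneg := hp0
  ev_one := by
    refine tendsto_nhds_unique (hp _) ?_
    simp only [sample, Fintype.expect_const]
    exact tendsto_const_nhds
  comap σ f := by
    refine tendsto_nhds_unique (hp _) ?_
    simpa only [sample_comap] using hp f
  regular f i j hij hf := by
    obtain ⟨C, hC⟩ := exists_abs_le f
    refine tendsto_nhds_unique (hp _) ?_
    refine squeeze_zero_norm (fun k => abs_sample_mul_adjSign_le (G k) f hij hf hC) ?_
    simpa using hdeg.const_mul C
  triangle f i j k hij hjk hik hi hj hk := by
    refine tendsto_nhds_unique (hp _) ?_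
    simp only [sample_mul_triangle _ f hij hjk hik hi hj hk]
    simpa using (hp f).mul htri
  gram h f i j hij hh hi hj hf :=
    ge_of_tendsto' (hp _) fun k => sample_gram_nonneg (G k) h f hij hh hi hj hf

/-! ### Return to finite graphs and sequences -/

/-- If `H` is not an induced subgraph of `G`, then its pattern is only seen in samples with
repeated vertices. -/
lemma sample_pattern_le {V : Type*} [Fintype V] [Nonempty V] (G : SimpleGraph V)
    (H : SimpleGraph (Fin 4)) (h : ¬ H.IsIndContained G) :
    sample (ι := Fin 6) G (fun ω => (1 + adjSign H 0 1 * adjSign ω 0 1) *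
      (1 + adjSign H 0 2 * adjSign ω 0 2) *
      (1 + adjSign H 1 2 * adjSign ω 1 2) * ((1 + adjSign H 0 3 * adjSign ω 0 3) *
      (1 + adjSign H 1 3 * adjSign ω 1 3) * (1 + adjSign H 2 3 * adjSign ω 2 3))) ≤
      64 * (36 / Fintype.card V) := by
  classical
  have h36 := expect_not_injective_le (V := V) 6
  norm_num at h36
  refine le_trans ?_ (mul_le_mul_of_nonneg_left h36 (by norm_num))
  rw [sample, Finset.mul_expect]
  refine Finset.expect_le_expect fun x _ => ?_
  simp only [adjSign_comap]
  have hfac : ∀ (a b : Fin 4) (c d : V), 1 + adjSign H a b * adjSign G c d = 0 ∨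
      (1 + adjSign H a b * adjSign G c d = 2 ∧ (G.Adj c d ↔ H.Adj a b)) := by
    intro a b c d
    by_cases h1 : H.Adj a b <;> by_cases h2 : G.Adj c d <;> simp [adjSign, adjInd, h1, h2] <;>
      norm_num
  rcases hfac 0 1 (x 0) (x 1) with h1 | ⟨h1, g1⟩
  · rw [h1]; simp only [zero_mul]; split_ifs <;> norm_num
  rcases hfac 0 2 (x 0) (x 2) with h2 | ⟨h2, g2⟩
  · rw [h2]; simp only [zero_mul, mul_zero]; split_ifs <;> norm_num
  rcases hfac 1 2 (x 1) (x 2) with h3 | ⟨h3, g3⟩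
  · rw [h3]; simp only [zero_mul, mul_zero]; split_ifs <;> norm_num
  rcases hfac 0 3 (x 0) (x 3) with h4 | ⟨h4, g4⟩
  · rw [h4]; simp only [zero_mul, mul_zero]; split_ifs <;> norm_num
  rcases hfac 1 3 (x 1) (x 3) with h5 | ⟨h5, g5⟩
  · rw [h5]; simp only [zero_mul, mul_zero]; split_ifs <;> norm_num
  rcases hfac 2 3 (x 2) (x 3) with h6 | ⟨h6, g6⟩
  · rw [h6]; simp only [mul_zero]; split_ifs <;> norm_num
  rw [h1, h2, h3, h4, h5, h6]
  split_ifs with hinj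
  · exfalso
    refine h ⟨⟨⟨fun i => x (Fin.castLE (by norm_num) i), fun a b hab => ?_⟩, ?_⟩⟩
    · exact Fin.castLE_injective _ (hinj hab)
    · intro a b
      have c0 : Fin.castLE (n := 4) (m := 6) (by norm_num) 0 = 0 := rfl
      have c1 : Fin.castLE (n := 4) (m := 6) (by norm_num) 1 = 1 := rfl
      have c2 : Fin.castLE (n := 4) (m := 6) (by norm_num) 2 = 2 := rfl
      have c3 : Fin.castLE (n := 4) (m := 6) (by norm_num) 3 = 3 := rfl
      have key : ∀ a b : Fin 4, a < b → (G.Adj (x (Fin.castLE (by norm_num) a))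
          (x (Fin.castLE (by norm_num) b)) ↔ H.Adj a b) := by
        intro a b hab
        fin_cases a <;> fin_cases b <;>
          first | exact g1 | exact g2 | exact g3 | exact g4 | exact g5 | exact g6 |
            exact absurd hab (by decide)
      rcases lt_trichotomy a b with hab | hab | hab
      · exact key a b hab
      · subst hab; simp
      · rw [H.adj_comm, ← key b a hab]
        exact G.adj_comm _ _
  · norm_num

/-- Large graphs with triangle and anti-triangle densities close to `1/8` contain any given
graph on four vertices. -/
lemma exists_bound_isIndContained (H : SimpleGraph (Fin 4)) :
    ∃ m : ℕ, ∀ (V : Type u) [Fintype V] (G : SimpleGraph V), m ≤ Fintype.card V →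
      density (⊥ : SimpleGraph (Fin 3)) G ≤ 1 / 8 + 1 / ((m : ℝ) + 1) →
      density (⊤ : SimpleGraph (Fin 3)) G ≤ 1 / 8 + 1 / ((m : ℝ) + 1) → H.IsIndContained G := by
  by_contra! hcon
  -- The shift by 3 guarantees the three vertices needed for the density bounds.
  choose V hV G hcard h0 h3 hH using fun m : ℕ => hcon (m + 3)
  have hne : ∀ m, Nonempty (V m) := fun m => Fintype.card_pos_iff.1 (by have := hcard m; omega)
  have hcardR : ∀ m : ℕ, (m : ℝ) + 1 ≤ Fintype.card (V m) := fun m => by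
    have : m + 1 ≤ Fintype.card (V m) := by have := hcard m; omega
    exact_mod_cast this
  have hpos : ∀ m : ℕ, (0 : ℝ) < (m : ℝ) + 1 := fun m => by positivity
  -- One unit for the density excess and nine for the collision term.
  set η : ℕ → ℝ := fun m => 10 * (1 / ((m : ℝ) + 1)) with hη
  have hη0 : Tendsto η atTop (𝓝 0) := by
    simpa [hη] using (tendsto_one_div_add_atTop_nhds_zero_nat (𝕜 := ℝ)).const_mul 10
  have hbound : ∀ m, (𝔼 v, |degSign (G m) v|) ≤ √(3 * η m) ∧
      |triSign (G m)| ≤ 8 * η m + 3 * √(3 * η m) := by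
    intro m
    have e1 : (1 : ℝ) / ((m + 3 : ℕ) + 1) ≤ 1 / ((m : ℝ) + 1) :=
      one_div_le_one_div_of_le (hpos m) (by push_cast; linarith)
    have e2 : (9 : ℝ) / Fintype.card (V m) ≤ 9 * (1 / ((m : ℝ) + 1)) := by
      rw [mul_one_div]
      exact div_le_div_of_nonneg_left (by norm_num) (hpos m) (hcardR m)
    have e3 : 0 < 1 / ((m : ℝ) + 1) := by have := hpos m; positivity
    refine degSign_triSign_bound (G m) (by have := hcard m; omega) ?_ ?_
    · simp only [hη]; linarith [h0 m]
    · simp only [hη]; linarith [h3 m]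
  have hsqrt : Tendsto (fun m => √(3 * η m)) atTop (𝓝 0) := by
    have := (Real.continuous_sqrt.tendsto _).comp (hη0.const_mul 3)
    simpa [Function.comp_def] using this
  have hdeg : Tendsto (fun m => 𝔼 v, |degSign (G m) v|) atTop (𝓝 0) :=
    squeeze_zero (fun m => Finset.expect_nonneg fun v _ => abs_nonneg _) (fun m => (hbound m).1)
      hsqrt
  have htri : Tendsto (fun m => triSign (G m)) atTop (𝓝 0) := by
    refine squeeze_zero_norm (fun m => (hbound m).2) ?_
    simpa using (hη0.const_mul 8).add (hsqrt.const_mul 3)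
  have hl : ((hyperfilter ℕ : Ultrafilter ℕ) : Filter ℕ) ≤ atTop := by
    rw [← Nat.cofinite_eq_atTop]; exact hyperfilter_le_cofinite
  obtain ⟨p, hp0, hp⟩ := exists_tendsto_sample G (hyperfilter ℕ)
  have hQ := isQuasiRegular_of_tendsto G _ (hdeg.mono_left hl) (htri.mono_left hl) hp0 hp
  refine (hQ.pattern_pos H).not_ge ?_
  -- Here 2304 = 64 · 36: the maximal pattern weight times the collision bound for six vertices.
  have hz : Tendsto (fun m : ℕ => 2304 * (1 / ((m : ℝ) + 1))) atTop (𝓝 0) := by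
    simpa using (tendsto_one_div_add_atTop_nhds_zero_nat (𝕜 := ℝ)).const_mul 2304
  refine le_of_tendsto_of_tendsto' (hp _) (hz.mono_left hl) fun m => ?_
  refine (sample_pattern_le (G m) H (hH m)).trans ?_
  have : (36 : ℝ) / Fintype.card (V m) ≤ 36 * (1 / ((m : ℝ) + 1)) := by
    rw [mul_one_div]
    exact div_le_div_of_nonneg_left (by norm_num) (hpos m) (hcardR m)
  linarith

/-- A finite form of the theorem. -/
lemma exists_bound_isUniversalGraph :
    ∃ m : ℕ, ∀ (V : Type u) [Fintype V] (G : SimpleGraph V), m ≤ Fintype.card V →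
      density (⊥ : SimpleGraph (Fin 3)) G ≤ 1 / 8 + 1 / ((m : ℝ) + 1) →
      density (⊤ : SimpleGraph (Fin 3)) G ≤ 1 / 8 + 1 / ((m : ℝ) + 1) →
      IsUniversalGraph 4 G := by
  choose m hm using exists_bound_isIndContained.{u}
  -- There are finitely many graphs on four vertices, so one threshold serves them all.
  obtain ⟨M, hM⟩ := (Set.finite_range m).bddAbove
  refine ⟨M, fun V _ G hc h0 h3 H => ?_⟩
  have hH : m H ≤ M := hM ⟨H, rfl⟩
  have hle : 1 / ((M : ℝ) + 1) ≤ 1 / ((m H : ℝ) + 1) :=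
    one_div_le_one_div_of_le (by positivity) (by have : (m H : ℝ) ≤ M := by exact_mod_cast hH
                                                 linarith)
  exact hm H V G (hH.trans hc) (by linarith) (by linarith)

end RandomLike


theorem theorem1 :
    (∀ 𝒢 : RandomLike.GraphSeq.{u}, 𝒢.IsRandomLike 3 → 𝒢.IsUniversal 4) ∧
    (∃ ε : ℝ, 0 < ε ∧ ∀ (𝒢 : RandomLike.GraphSeq.{u}) (p₀ p₃ : ℝ),
      𝒢.HasDensity (⊥ : SimpleGraph (Fin 3)) p₀ → 𝒢.HasDensity (⊤ : SimpleGraph (Fin 3)) p₃ →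
      p₀ < 1 / 8 + ε → p₃ < 1 / 8 + ε → 𝒢.IsUniversal 4) := by
  obtain ⟨m, hm⟩ := RandomLike.exists_bound_isUniversalGraph.{u}
  have hε : (0 : ℝ) < 1 / ((m : ℝ) + 1) := by positivity
  have main : ∀ (𝒢 : RandomLike.GraphSeq.{u}) (p₀ p₃ : ℝ),
      𝒢.HasDensity (⊥ : SimpleGraph (Fin 3)) p₀ → 𝒢.HasDensity (⊤ : SimpleGraph (Fin 3)) p₃ →
      p₀ < 1 / 8 + 1 / ((m : ℝ) + 1) → p₃ < 1 / 8 + 1 / ((m : ℝ) + 1) → 𝒢.IsUniversal 4 := by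
    intro 𝒢 p₀ p₃ h0 h3 hp0 hp3
    filter_upwards [𝒢.tendsto_order.eventually_ge_atTop m, h0.eventually_lt_const hp0,
      h3.eventually_lt_const hp3] with k hk h0k h3k
    exact hm _ _ hk h0k.le h3k.le
  -- The random-like case is the instance where both limits equal `(1 / 2) ^ 3 = 1 / 8`.
  refine ⟨fun 𝒢 h => main 𝒢 _ _ h.2 h.1 ?_ ?_, _, hε, main⟩ <;>
  · norm_num [Nat.choose]
    positivity
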